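/- Let $k\ge 3$, $m\ge 0$ be integers and let $0\le\alpha<1$. All hypergraphs are finite, simple and $k$-uniform. The degree $d_v$ of a vertex $v$ is the number of edges containing it. For a hypergraph $G$ with vertex set $\{v_1,\dots,v_n\}$, the tensor $\mathcal A_\alpha(G)=\alpha\,\mathcal D(G)+(1-\alpha)\,\mathcal A(G)$ of order $k$ and dimension $n$ is built from the diagonal degree tensor $\mathcal D(G)$ and the adjacency tensor $\mathcal A(G)$, whose entry at $(i_1,\dots,i_k)$ is $\frac1{(k-1)!}$ if $\{v_{i_1},\dots,v_{i_k}\}$ is an edge and $0$ otherwise. An eigenvalue of a tensor $\mathcal A$ is a $\lambda\in\mathbb C$ with $\mathcal A x=\lambda x^{[k-1]}$ for some nonzero $x\in\mathbb C^n$, where $(\mathcal A x)_i=\sum_{i_2,\dots,i_k}a_{i i_2\cdots i_k}x_{i_2}\cdots x_{i_k}$ and $x^{[k-1]}=(x_1^{k-1},\dots,x_n^{k-1})$; $\rho_\alpha(G)$ is the largest modulus of an eigenvalue of $\mathcal A_\alpha(G)$. A supertree is a connected acyclic hypergraph. An edge is pendant if all of its vertices, except at most one, have degree one. A supertree is a caterpillar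 if removing all its pendant edges leaves a loose path, that is, edges $e_1,\dots,e_d$ ($d\ge 0$) with $|e_i\cap e_j|=1$ if $|i-j|=1$ and $e_i\cap e_j=\varnothing$ if $|i-j|\geq 2$. Let $NC(m)$ be the set of $k$-uniform supertrees with $m$ edges that are not caterpillars (it is empty if $m<6$). The double star $S(s,t)$ is the tree obtained from a single edge by attaching $s$ pendant edges to one end and $t$ pendant edges to the other. Let $T(s,t;a,b)$ be the tree obtained from $S(s,t)$ by attaching two paths of lengths $a$ and $b$ to the central vertex with $t$ pendant edges, and let $T^k(s,t;a,b)$ be its $k$-th power, the hypergraph obtained by adding $k-2$ new vertices to each edge. For $m\ge 6$ put $H_1(m,4)=T^k(1,m-6;2,2)$ and $H_2(m,4)=T^k(m-5,0;2,2)$. **Theorem.** If $G\in NC(m)$, then $$\rho_\alpha(G)\le\max\{\rho_\alpha(H_1(m,4)),\rho_\alpha(H_2(m,4))\}.$$ Equality holds if and only if $G$ is isomorphic to one of $H_1(m,4)$, $H_2(m,4)$ whose $\alpha$-spectral radius attains this maximum; that is, if and only if $G\cong H_1(m,4)$ and $\rho_\alpha(H_1(m,4))\ge\rho_\alpha(H_2(m,4))$,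 or $G\cong H_2(m,4)$ and $\rho_\alpha(H_2(m,4))\ge\rho_\alpha(H_1(m,4))$. In particular, equality holds only if $G\cong H_1(m,4)$ or $G\cong H_2(m,4)$. -/

import Mathlib

noncomputable section

/-! ### Tensors and their spectral radius -/

namespace HyperTensor

/-- For a real tensor `A` of order `k` with index set `n` and a complex vector `x`, the vector
`A x`, whose `i`-th entry is `∑ a_{i i₂ ⋯ i_k} x_{i₂} ⋯ x_{i_k}`, the sum being over all
`i₂, …, i_k`.  (The multi-index is `f : Fin k → n`, and its first entry is `f 0`.) -/
def mulVec {n : Type*} [Fintype n] {k : ℕ} [NeZero k] (A : (Fin k → n) → ℝ) (x : n → ℂ)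
    (i : n) : ℂ :=
  open Classical in
  ∑ f : Fin k → n with f 0 = i, (A f : ℂ) * ∏ t ∈ Finset.univ.erase (0 : Fin k), x (f t)

/-- `μ` is an eigenvalue of `A`: `A x = μ x^{[k-1]}` for some nonzero complex vector `x`. -/
def IsEigenvalue {n : Type*} [Fintype n] {k : ℕ} [NeZero k] (A : (Fin k → n) → ℝ) (μ : ℂ) :
    Prop :=
  ∃ x : n → ℂ, x ≠ 0 ∧ ∀ i, mulVec A x i = μ * x i ^ (k - 1)

/-- The spectral radius of a tensor: the largest modulus of its eigenvalues. -/
def spectralRadius {n : Type*} [Fintype n] {k : ℕ} [NeZero k] (A : (Fin k → n) → ℝ) : ℝ :=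
  sSup {r : ℝ | ∃ μ : ℂ, IsEigenvalue A μ ∧ r = ‖μ‖}

end HyperTensor

/-! ### Hypergraphs -/

namespace Hypergraph

/-- Every edge has exactly `k` vertices. -/
def IsUniform {V : Type*} (H : Hypergraph V) (k : ℕ) : Prop :=
  ∀ e ∈ H.edgeSet, e.ncard = k

/-- The number of edges containing `v`. -/
def degree {V : Type*} (H : Hypergraph V) (v : V) : ℕ :=
  {e | e ∈ H.edgeSet ∧ v ∈ e}.ncard

/-- The bipartite vertex-edge incidence graph of `H`.  Its walks are the alternating sequences
`v₀ e₁ v₁ e₂ v₂ …` of vertices and edges of `H` in which neighbouring terms are incident. -/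
def incidenceGraph {V : Type*} (H : Hypergraph V) :
    SimpleGraph (H.vertexSet ⊕ H.edgeSet) where
  Adj
    | Sum.inl v, Sum.inr e => (v : V) ∈ (e : Set V)
    | Sum.inr e, Sum.inl v => (v : V) ∈ (e : Set V)
    | _, _ => False
  symm := ⟨by rintro (a | a) (b | b) h <;> exact h⟩
  loopless := ⟨by rintro (a | a) h <;> exact h⟩

/-- `H` is connected: there is a walk `v₀ e₁ v₁ … e_r v_r` between any two vertices. -/
def IsConnected {V : Type*} (H : Hypergraph V) : Prop :=
  H.incidenceGraph.Connected

/-- `H` is acyclic: there is no cycle `v₁ e₁ v₂ e₂ … v_r e_r v₁` with `r ≥ 2` distinct vertices and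
`r` distinct edges, where `v_i, v_{i+1} ∈ e_i`. -/
def IsAcyclic {V : Type*} (H : Hypergraph V) : Prop :=
  H.incidenceGraph.IsAcyclic

/-- A supertree is a connected acyclic hypergraph. -/
def IsSupertree {V : Type*} (H : Hypergraph V) : Prop :=
  H.IsConnected ∧ H.IsAcyclic

/-- An edge is pendant if all its vertices, except at most one, have degree one. -/
def IsPendantEdge {V : Type*} (H : Hypergraph V) (e : Set V) : Prop :=
  e ∈ H.edgeSet ∧ {v | v ∈ e ∧ H.degree v ≠ 1}.Subsingleton

/-- The set `F` of edges forms a loose path `e₁, …, e_d`: consecutive edges meet in exactly one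
vertex, all other pairs of edges are disjoint.  The path of length `d = 0` is allowed. -/
def IsLoosePath {V : Type*} (F : Set (Set V)) : Prop :=
  ∃ (d : ℕ) (e : Fin d → Set V), Function.Injective e ∧ Set.range e = F ∧
    (∀ i j : Fin d, (j : ℕ) = i + 1 → ∃ v, e i ∩ e j = {v}) ∧
    (∀ i j : Fin d, (i : ℕ) + 1 < j → Disjoint (e i) (e j))

/-- A caterpillar is a supertree in which the removal of all pendant edges leaves a loose path
(vertices that are no longer in any edge being discarded). -/
def IsCaterpillar {V : Type*} (H : Hypergraph V) : Prop :=
  H.IsSupertree ∧ IsLoosePath {e | e ∈ H.edgeSet ∧ ¬ H.IsPendantEdge e}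

/-- `H` belongs to `NC(m)`: it is a `k`-uniform supertree with `m` edges and is not a
caterpillar. -/
def IsNonCaterpillar {V : Type*} (k m : ℕ) (H : Hypergraph V) : Prop :=
  H.IsUniform k ∧ H.IsSupertree ∧ H.edgeSet.ncard = m ∧ ¬ H.IsCaterpillar

/-- Isomorphism: a bijection between the vertex sets under which edges correspond to edges. -/
def IsIsomorphic {V W : Type*} (H : Hypergraph V) (K : Hypergraph W) : Prop :=
  ∃ σ : H.vertexSet ≃ K.vertexSet, ∀ e : Set H.vertexSet,
    Subtype.val '' e ∈ H.edgeSet ↔ Subtype.val '' (σ '' e) ∈ K.edgeSet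

/-! ### The `α`-spectral radius -/

/-- The adjacency tensor: the entry at `(i₁, …, i_k)` is `1 / (k - 1)!` if `{i₁, …, i_k}` is an
edge, and `0` otherwise. -/
def adjTensor {V : Type*} (H : Hypergraph V) (k : ℕ) (f : Fin k → H.vertexSet) : ℝ :=
  open Classical in
  if Set.range (fun t => (f t : V)) ∈ H.edgeSet then 1 / ((k - 1).factorial : ℝ) else 0

/-- The degree tensor: diagonal, with the degrees of the vertices as diagonal entries. -/
def degTensor {V : Type*} (H : Hypergraph V) (k : ℕ) [NeZero k] (f : Fin k → H.vertexSet) : ℝ :=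
  open Classical in
  if ∀ t, f t = f 0 then (H.degree (f 0 : V) : ℝ) else 0

/-- The tensor `A_α(H) = α D(H) + (1 - α) A(H)`. -/
def alphaTensor {V : Type*} (H : Hypergraph V) (k : ℕ) [NeZero k] (α : ℝ)
    (f : Fin k → H.vertexSet) : ℝ :=
  α * H.degTensor k f + (1 - α) * H.adjTensor k f

/-- The `α`-spectral radius of a finite `k`-uniform hypergraph. -/
def alphaSpectralRadius {V : Type*} (k : ℕ) [NeZero k] (α : ℝ) (H : Hypergraph V)
    [Finite H.vertexSet] : ℝ :=
  letI : Fintype H.vertexSet := Fintype.ofFinite _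
  HyperTensor.spectralRadius (H.alphaTensor k α)

/-- The `k`-th power of a simple graph: `k - 2` new vertices are added to each edge. -/
def power {V : Type*} (T : SimpleGraph V) (k : ℕ) :
    Hypergraph (V ⊕ (T.edgeSet × Fin (k - 2))) where
  vertexSet := Set.univ
  edgeSet := Set.range fun e : T.edgeSet =>
    Sum.inl '' {v : V | v ∈ (e : Sym2 V)} ∪ Sum.inr '' {p : T.edgeSet × Fin (k - 2) | p.1 = e}
  subset_vertexSet_of_mem_edgeSet' := fun _ _ => Set.subset_univ _

end Hypergraph

/-! ### The extremal hypertrees -/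

/-- The vertices of the tree `T(s, t; a, b)`: the two centres `u` and `v` of the double star
`S(s, t)`, its `s` leaves at `u` and its `t` leaves at `v`, and the vertices (other than `v`) of
the two paths of lengths `a` and `b` attached at `v`. -/
inductive TreeVertex (s t a b : ℕ) : Type
  | u : TreeVertex s t a b
  | v : TreeVertex s t a b
  | leafU (i : Fin s) : TreeVertex s t a b
  | leafV (i : Fin t) : TreeVertex s t a b
  | pathA (i : Fin a) : TreeVertex s t a b
  | pathB (i : Fin b) : TreeVertex s t a b
  deriving Fintype

/-- The edges of `T(s, t; a, b)`, each listed in one direction. -/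
inductive TreeEdge (s t a b : ℕ) : TreeVertex s t a b → TreeVertex s t a b → Prop
  | centre : TreeEdge s t a b .u .v
  | leafU (i : Fin s) : TreeEdge s t a b .u (.leafU i)
  | leafV (i : Fin t) : TreeEdge s t a b .v (.leafV i)
  | startA (i : Fin a) (h : (i : ℕ) = 0) : TreeEdge s t a b .v (.pathA i)
  | startB (i : Fin b) (h : (i : ℕ) = 0) : TreeEdge s t a b .v (.pathB i)
  | stepA (i j : Fin a) (h : (j : ℕ) = i + 1) : TreeEdge s t a b (.pathA i) (.pathA j)
  | stepB (i j : Fin b) (h : (j : ℕ) = i + 1) : TreeEdge s t a b (.pathB i) (.pathB j)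

/-- The tree `T(s, t; a, b)`: two paths of lengths `a` and `b` are attached to the vertex of degree
`t + 1` of the double star `S(s, t)`. -/
def treeT (s t a b : ℕ) : SimpleGraph (TreeVertex s t a b) :=
  SimpleGraph.fromRel (TreeEdge s t a b)

/-- `H₁(m, d) = T^k(1, m - d - 2; ⌊d/2⌋, d - ⌊d/2⌋)`, used for `4 ≤ d ≤ m - 2`. -/
abbrev hypertreeOne (k m d : ℕ) :=
  Hypergraph.power (treeT 1 (m - d - 2) (d / 2) (d - d / 2)) k

/-- `H₂(m, d) = T^k(m - d - 1, 0; ⌊d/2⌋, d - ⌊d/2⌋)`, used for `4 ≤ d ≤ m - 2`. -/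
abbrev hypertreeTwo (k m d : ℕ) :=
  Hypergraph.power (treeT (m - d - 1) 0 (d / 2) (d - d / 2)) k

end

/-!
The spectral radius `ρ_α(G)` is the maximum of the form
`∑_e (α ∑_{v ∈ e} x_v^k + (1 - α) k ∏_{v ∈ e} x_v)` relative to `∑_v x_v^k` over nonnegative `x`
(`Hypergraph.IsEdgeFamily.alphaSpectralRadius_eq`), and for a connected `G` a maximizer `x` is a
positive eigenvector.

Let `G` be a supertree that is not a caterpillar, `x` a maximizer, and `z` a vertex at which `x` is
largest. Root `G` at `z`, so that every edge has a top vertex, the one closest to `z`. Replacing the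
top vertices of any set of edges by `z` cannot decrease the form at `x`; so the new hypergraph has
at least the spectral radius of `G`, and if the two agree, then the eigenvalue equations at `z`
show that no edge has been changed (`EdgeFamily.IsMaximizer.le_of_shift`).

Which edges to keep is dictated by the branching of `G`. As `G` is not a caterpillar, three
non-pendant edges meet in a vertex, or three vertices of an edge lie on further non-pendant edges;
otherwise the non-pendant edges form a path (`Rooting.exists_path`). Seen from `z`, there are
therefore either three disjoint pairs consisting of an edge and an edge hanging from it, or an edge
with two edges hanging from it at the same vertex, each with a further edge hanging from it
(`Rooting.hasThreePairs_or_hasFork`). In the first case all edges are moved to `z` except for the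
lower edges of the three pairs, which gives `H₁(m, 4)`; in the second case all edges are moved
except for the two edges and those hanging from them, which gives `H₂(m, 4)`. That the outcome is
the extremal hypertree follows from `EdgeFamily.Branching.exists_equiv`: a hypertree in which the
edges hanging from an edge all do so at one vertex is determined by its tree of edges.
-/

/-! ### The variational description of the spectral radius -/

namespace EdgeFamily

open Finset

variable {A ι : Type*} {k : ℕ} {α ρ : ℝ} {x : A → ℝ}

/-- The contribution `α ∑_{v ∈ s} x_v^k + (1 - α) k ∏_{v ∈ s} x_v` of an edge `s` to the form
`xᵀ (A_α x)`. -/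
def edgeForm (k : ℕ) (α : ℝ) (s : Finset A) (x : A → ℝ) : ℝ :=
  α * ∑ v ∈ s, x v ^ k + (1 - α) * k * ∏ v ∈ s, x v

lemma edgeForm_smul {s : Finset A} (hs : s.card = k) (c : ℝ) (x : A → ℝ) :
    edgeForm k α s (c • x) = c ^ k * edgeForm k α s x := by
  simp only [edgeForm, Pi.smul_apply, smul_eq_mul, mul_pow, prod_mul_distrib, prod_const, hs,
    ← mul_sum]
  ring

lemma edgeForm_mono {s : Finset A} {y : A → ℝ} (hα0 : 0 ≤ α) (hα1 : α ≤ 1) (hx : 0 ≤ x)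
    (hxy : x ≤ y) : edgeForm k α s x ≤ edgeForm k α s y := by
  unfold edgeForm
  have h1 : ∑ v ∈ s, x v ^ k ≤ ∑ v ∈ s, y v ^ k :=
    sum_le_sum fun v _ => pow_le_pow_left₀ (hx v) (hxy v) k
  have h2 : ∏ v ∈ s, x v ≤ ∏ v ∈ s, y v := prod_le_prod (fun v _ => hx v) fun v _ => hxy v
  have h3 : 0 ≤ (1 - α) * k := mul_nonneg (by linarith) (Nat.cast_nonneg k)
  gcongr

variable [Fintype ι]

/-- The degree `k` form `xᵀ (A_α x)` of the hypergraph with edges `E i`. -/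
def form (E : ι → Finset A) (k : ℕ) (α : ℝ) (x : A → ℝ) : ℝ :=
  ∑ i, edgeForm k α (E i) x

lemma form_smul {E : ι → Finset A} (hE : ∀ i, (E i).card = k) (c : ℝ) (x : A → ℝ) :
    form E k α (c • x) = c ^ k * form E k α x := by
  simp only [form, mul_sum, edgeForm_smul (hE _)]

lemma continuous_form {E : ι → Finset A} : Continuous (form E k α) := by
  unfold form edgeForm
  fun_prop

variable [Fintype A]

lemma sum_pow_pos (hx : 0 ≤ x) (hx0 : x ≠ 0) : 0 < ∑ v, x v ^ k := by
  obtain ⟨a, ha⟩ := Function.ne_iff.mp hx0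
  refine sum_pos' (fun v _ => pow_nonneg (hx v) k) ⟨a, mem_univ a, ?_⟩
  exact pow_pos (lt_of_le_of_ne (hx a) (Ne.symm ha)) k

/-- The vector `A_α x` of the hypergraph with edges `E i`. -/
def apply [DecidableEq A] (E : ι → Finset A) (k : ℕ) (α : ℝ) (x : A → ℝ) (v : A) : ℝ :=
  ∑ i with v ∈ E i, (α * x v ^ (k - 1) + (1 - α) * ∏ w ∈ (E i).erase v, x w)

/-- `ρ ∑ y_v^k` dominates the form on nonnegative vectors. -/
def FormLE (E : ι → Finset A) (k : ℕ) (α ρ : ℝ) : Prop :=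
  ∀ y : A → ℝ, 0 ≤ y → form E k α y ≤ ρ * ∑ v, y v ^ k

/-- `x` is a nonnegative vector at which the form attains its maximum `ρ` relative to
`∑ x_v^k`. -/
structure IsMaximizer (E : ι → Finset A) (k : ℕ) (α ρ : ℝ) (x : A → ℝ) : Prop where
  le : FormLE E k α ρ
  nonneg : 0 ≤ x
  pos : 0 < ∑ v, x v ^ k
  eq : form E k α x = ρ * ∑ v, x v ^ k

variable {E : ι → Finset A}

lemma sum_mul_apply [DecidableEq A] (hE : ∀ i, (E i).card = k) (hk : 1 ≤ k) (x : A → ℝ) :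
    ∑ v, x v * apply E k α x v = form E k α x := by
  unfold apply form edgeForm
  simp_rw [mul_sum, sum_filter]
  rw [sum_comm]
  refine sum_congr rfl fun i _ => ?_
  rw [← sum_filter, filter_mem_eq_inter, univ_inter]
  have : ∀ v ∈ E i, x v * (α * x v ^ (k - 1) + (1 - α) * ∏ w ∈ (E i).erase v, x w)
      = α * x v ^ k + (1 - α) * ∏ w ∈ E i, x w := by
    intro v hv
    rw [← mul_prod_erase _ _ hv, mul_add]
    obtain ⟨n, rfl⟩ : ∃ n, k = n + 1 := ⟨k - 1, by omega⟩
    simp only [Nat.add_sub_cancel, pow_succ]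
    ring
  rw [sum_congr rfl this, sum_add_distrib, sum_const, hE i]
  simp
  ring

/-- The form attains its maximum on the compact set `∑ x_v^k = 1`, `x ≥ 0`. -/
lemma exists_isMaximizer [Nonempty A] (hE : ∀ i, (E i).card = k) (hk : k ≠ 0) (α : ℝ) :
    ∃ ρ x, IsMaximizer E k α ρ x := by
  classical
  set K : Set (A → ℝ) := {x | 0 ≤ x ∧ ∑ v, x v ^ k = 1} with hK
  have hKc : IsCompact K := by
    refine IsCompact.of_isClosed_subset (isCompact_Icc (a := (0 : A → ℝ)) (b := 1)) ?_ ?_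
    · exact (isClosed_le continuous_const continuous_id).inter
        (isClosed_eq (by fun_prop) continuous_const)
    · rintro x ⟨hx, hx1⟩
      refine ⟨hx, fun v => ?_⟩
      have h1 : x v ^ k ≤ 1 := hx1 ▸
        single_le_sum (f := fun v => x v ^ k) (fun v _ => pow_nonneg (hx v) k) (mem_univ v)
      exact (pow_le_one_iff_of_nonneg (hx v) hk).mp h1
  have hKn : K.Nonempty := by
    obtain ⟨a⟩ := ‹Nonempty A›
    refine ⟨Pi.single a 1, by simp [Pi.single_nonneg], ?_⟩
    rw [sum_eq_single a] <;> simp +contextual [hk]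
  obtain ⟨x, hxK, hmax⟩ := hKc.exists_isMaxOn hKn (continuous_form (E := E) (k := k) (α := α)).continuousOn
  refine ⟨form E k α x, x, ?_, hxK.1, by rw [hxK.2]; exact one_pos, by rw [hxK.2, mul_one]⟩
  intro y hy
  by_cases hy0 : y = 0
  · subst hy0
    have := form_smul (α := α) hE 0 (0 : A → ℝ)
    simp only [zero_smul, zero_pow hk, zero_mul] at this
    simp [this, hk]
  have hS := sum_pow_pos (k := k) hy hy0
  set S := ∑ v, y v ^ k with hSdef
  -- `c` scales `y` to a vector with `∑ y_v^k = 1`.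
  set c : ℝ := S ^ (-(1 / k : ℝ)) with hc
  have hck : c ^ k = S⁻¹ := by
    rw [hc, ← Real.rpow_natCast, ← Real.rpow_mul hS.le]
    have : (-(1 / k : ℝ)) * k = -1 := by field_simp
    rw [this, Real.rpow_neg_one]
  have hcy : c • y ∈ K := by
    refine ⟨smul_nonneg (Real.rpow_nonneg hS.le _) hy, ?_⟩
    simp only [Pi.smul_apply, smul_eq_mul, mul_pow, ← mul_sum, hck]
    exact inv_mul_cancel₀ hS.ne'
  have h := hmax hcy
  simp only [Set.mem_ofPred_eq, form_smul hE, hck] at h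
  rwa [inv_mul_le_iff₀ hS, mul_comm] at h

/-- The one-variable first-order condition at a maximum over `t ≥ 0`. At the boundary point `s = 0`
the maximum only gives `c ≤ 0`, so that `0 ≤ c` is needed. -/
lemma mul_pow_add_mul_stationary {a c s : ℝ} (hk : 2 ≤ k) (hs : 0 ≤ s) (hc : 0 ≤ c)
    (h : ∀ t, 0 ≤ t → a * t ^ k + c * t ≤ a * s ^ k + c * s) : k * a * s ^ (k - 1) + c = 0 := by
  rcases hs.eq_or_lt with rfl | hs
  · rw [zero_pow (by omega), mul_zero, zero_add]
    simp only [mul_zero, add_zero, zero_pow (by omega : k ≠ 0)] at h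
    by_contra hne
    have hc : 0 < c := lt_of_le_of_ne hc (Ne.symm hne)
    set t := min 1 (c / (2 * (|a| + 1))) with ht
    have ht0 : 0 < t := lt_min one_pos (by positivity)
    have h1 : t ≤ 1 := min_le_left _ _
    have h2 : t * (2 * (|a| + 1)) ≤ c := by
      rw [← le_div_iff₀ (by positivity)]; exact min_le_right _ _
    have h3 := h t ht0.le
    have h4 : t ^ k ≤ t ^ 2 := pow_le_pow_of_le_one ht0.le h1 hk
    have h5 : -(|a| * t ^ 2) ≤ a * t ^ k := by
      have : |a| * t ^ k ≤ |a| * t ^ 2 := mul_le_mul_of_nonneg_left h4 (abs_nonneg a)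
      have h6 := mul_le_mul_of_nonneg_right (neg_abs_le a) (pow_nonneg ht0.le k)
      linarith
    have h7 : c * t ≤ |a| * t * t := by nlinarith
    have h8 : c ≤ |a| * t := le_of_mul_le_mul_right h7 ht0
    nlinarith [abs_nonneg a]
  · have hd : HasDerivAt (fun t : ℝ => a * t ^ k + c * t) (a * (k * s ^ (k - 1)) + c * 1) s :=
      ((hasDerivAt_pow k s).const_mul a).add ((hasDerivAt_id s).const_mul c)
    have hm : IsLocalMax (fun t : ℝ => a * t ^ k + c * t) s := by
      filter_upwards [lt_mem_nhds hs] with t ht using h t ht.le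
    have := hm.hasDerivAt_eq_zero hd
    linarith

/-- A maximizer satisfies the eigenvalue equations: the form minus `ρ ∑ x_v^k`, as a function of a
single coordinate, is largest at the coordinate of the maximizer. -/
lemma IsMaximizer.apply_eq [DecidableEq A] (h : IsMaximizer E k α ρ x) (hk : 2 ≤ k) (hα1 : α ≤ 1) (v : A) :
    apply E k α x v = ρ * x v ^ (k - 1) := by
  classical
  set d : ℝ := ((univ.filter fun i => v ∈ E i).card : ℝ) with hd
  set C : ℝ := ∑ i with v ∈ E i, ∏ w ∈ (E i).erase v, x w with hC
  have hC0 : 0 ≤ C := sum_nonneg fun i _ => prod_nonneg fun w _ => h.nonneg w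
  have hform : ∃ c₀ : ℝ, ∀ t, form E k α (Function.update x v t) =
      c₀ + α * d * t ^ k + (1 - α) * k * C * t := by
    refine ⟨∑ i with v ∈ E i, α * ∑ w ∈ (E i).erase v, x w ^ k
      + ∑ i with v ∉ E i, edgeForm k α (E i) x, fun t => ?_⟩
    unfold form
    rw [← sum_filter_add_sum_filter_not univ (fun i => v ∈ E i)]
    have h1 : ∀ i ∈ univ.filter (fun i => v ∈ E i), edgeForm k α (E i) (Function.update x v t) =
        α * ∑ w ∈ (E i).erase v, x w ^ k + α * t ^ k
          + (1 - α) * k * t * ∏ w ∈ (E i).erase v, x w := by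
      intro i hi
      have hi := (mem_filter.mp hi).2
      unfold edgeForm
      rw [← add_sum_erase _ _ hi, ← mul_prod_erase _ _ hi]
      have e1 : ∑ w ∈ (E i).erase v, Function.update x v t w ^ k
          = ∑ w ∈ (E i).erase v, x w ^ k :=
        sum_congr rfl fun w hw => by rw [Function.update_of_ne (ne_of_mem_erase hw)]
      have e2 : ∏ w ∈ (E i).erase v, Function.update x v t w = ∏ w ∈ (E i).erase v, x w :=
        prod_congr rfl fun w hw => by rw [Function.update_of_ne (ne_of_mem_erase hw)]
      rw [e1, e2, Function.update_self]
      ring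
    have h2 : ∀ i ∈ univ.filter (fun i => v ∉ E i), edgeForm k α (E i) (Function.update x v t) =
        edgeForm k α (E i) x := by
      intro i hi
      have hi := (mem_filter.mp hi).2
      have hne : ∀ w ∈ E i, Function.update x v t w = x w := fun w hw =>
        Function.update_of_ne (fun hwv => hi (by rwa [← hwv])) _ _
      unfold edgeForm
      rw [prod_congr rfl hne, sum_congr rfl fun w hw => by rw [hne w hw]]
    rw [sum_congr rfl h1, sum_congr rfl h2, sum_add_distrib, sum_add_distrib, sum_const,
      nsmul_eq_mul, ← mul_sum, ← mul_sum, hC, hd]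
    ring
  obtain ⟨c₀, hc₀⟩ := hform
  have hsum : ∀ t, ∑ w, Function.update x v t w ^ k
      = ∑ w ∈ univ.erase v, x w ^ k + t ^ k := by
    intro t
    rw [← add_sum_erase _ _ (mem_univ v), Function.update_self, add_comm]
    congr 1
    exact sum_congr rfl fun w hw => by rw [Function.update_of_ne (ne_of_mem_erase hw)]
  have key := mul_pow_add_mul_stationary (a := α * d - ρ) (c := (1 - α) * k * C) (s := x v) hk
    (h.nonneg v) (mul_nonneg (mul_nonneg (by linarith) (Nat.cast_nonneg k)) hC0) (by
      intro t ht
      have h1 := h.le (Function.update x v t) (by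
        intro w
        by_cases hw : w = v
        · subst hw; simpa using ht
        · simpa [Function.update_of_ne hw] using h.nonneg w)
      have h2 := h.eq
      rw [← Function.update_eq_self v x] at h2
      rw [hc₀, hsum] at h1 h2
      linarith)
  have hk0 : (k : ℝ) ≠ 0 := by positivity
  have : apply E k α x v = α * d * x v ^ (k - 1) + (1 - α) * C := by
    unfold apply
    rw [sum_add_distrib, sum_const, ← mul_sum, nsmul_eq_mul]
    ring
  rw [this]
  apply mul_left_cancel₀ hk0
  linarith

/-- The zero set of a maximizer is closed under edges: raising the `j < k` zeros of an edge to `ε`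
raises the form by the order of `ε ^ j` and `∑ x_v ^ k` only by the order of `ε ^ k`. -/
lemma IsMaximizer.eq_zero_of_mem (h : IsMaximizer E k α ρ x) (hE : ∀ i, (E i).card = k)
    (hα0 : 0 ≤ α) (hα1 : α < 1) {i : ι} {a b : A} (ha : a ∈ E i) (hb : b ∈ E i)
    (hxa : x a = 0) : x b = 0 := by
  classical
  by_contra hxb
  set Z := (E i).filter fun v => x v = 0 with hZ
  have haZ : a ∈ Z := mem_filter.mpr ⟨ha, hxa⟩
  have hj : Z.card < k := by
    rw [← hE i]
    exact card_lt_card ((filter_ssubset).mpr ⟨b, hb, hxb⟩)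
  have hk0 : 0 < k := lt_of_le_of_lt (Nat.zero_le _) hj
  set c : ℝ := ∏ v ∈ E i with ¬ x v = 0, x v with hc
  have hc0 : 0 < c := prod_pos fun v hv =>
    lt_of_le_of_ne (h.nonneg v) (Ne.symm (mem_filter.mp hv).2)
  have key : ∀ ε : ℝ, 0 < ε → ε ≤ 1 → (1 - α) * k * c ≤ |ρ| * Z.card * ε := by
    intro ε hε hε1
    set y : A → ℝ := fun v => if v ∈ Z then ε else x v with hy
    have hxy : x ≤ y := by
      intro v
      by_cases hv : v ∈ Z
      · simp [hy, hv, (mem_filter.mp hv).2, hε.le]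
      · simp [hy, hv]
    have hy0 : 0 ≤ y := h.nonneg.trans hxy
    have hprod : ∏ v ∈ E i, y v = ε ^ Z.card * c := by
      rw [← prod_filter_mul_prod_filter_not (E i) (fun v => x v = 0), ← hZ, hc]
      congr 1
      · rw [prod_congr rfl (g := fun _ => ε) fun v hv => by simp [hy, hv], prod_const]
      · refine prod_congr rfl fun v hv => ?_
        have : v ∉ Z := fun hvZ => (mem_filter.mp hv).2 (mem_filter.mp hvZ).2
        simp [hy, this]
    have hprod0 : ∏ v ∈ E i, x v = 0 := prod_eq_zero ha hxa
    have hform : form E k α x + (1 - α) * k * (ε ^ Z.card * c) ≤ form E k α y := by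
      unfold form
      rw [← add_sum_erase _ _ (mem_univ i), ← add_sum_erase _ _ (mem_univ i)]
      have h1 : ∑ j ∈ univ.erase i, edgeForm k α (E j) x ≤ ∑ j ∈ univ.erase i, edgeForm k α (E j) y :=
        sum_le_sum fun j _ => edgeForm_mono hα0 hα1.le h.nonneg hxy
      have h2 : edgeForm k α (E i) x + (1 - α) * k * (ε ^ Z.card * c) ≤ edgeForm k α (E i) y := by
        unfold edgeForm
        rw [hprod, hprod0]
        have : ∑ v ∈ E i, x v ^ k ≤ ∑ v ∈ E i, y v ^ k :=
          sum_le_sum fun v _ => pow_le_pow_left₀ (h.nonneg v) (hxy v) k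
        have := mul_le_mul_of_nonneg_left this hα0
        linarith
      linarith
    have hsum : ∑ v, y v ^ k = ∑ v, x v ^ k + Z.card * ε ^ k := by
      have : ∀ v, y v ^ k = x v ^ k + if v ∈ Z then ε ^ k else 0 := by
        intro v
        by_cases hv : v ∈ Z
        · simp [hy, hv, (mem_filter.mp hv).2, hk0.ne']
        · simp [hy, hv]
      simp_rw [this]
      rw [sum_add_distrib, ← sum_filter, sum_const]
      simp
    have hle := h.le y hy0
    rw [hsum, mul_add, ← h.eq] at hle
    have h3 : (1 - α) * k * (ε ^ Z.card * c) ≤ ρ * (Z.card * ε ^ k) := by linarith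
    have h4 : ε ^ k ≤ ε ^ (Z.card + 1) := pow_le_pow_of_le_one hε.le hε1 hj
    have h5 : ρ * (Z.card * ε ^ k) ≤ |ρ| * (Z.card * ε ^ (Z.card + 1)) := by
      have := le_abs_self ρ
      gcongr
    have h6 : ε ^ Z.card * ((1 - α) * k * c) ≤ ε ^ Z.card * (|ρ| * Z.card * ε) := by
      rw [pow_succ] at h5
      linarith
    exact le_of_mul_le_mul_left h6 (pow_pos hε _)
  have hpos : 0 < (1 - α) * k * c := mul_pos (mul_pos (by linarith) (by exact_mod_cast hk0)) hc0
  set q : ℝ := (1 - α) * k * c with hq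
  have hB : 0 ≤ |ρ| * Z.card := by positivity
  have h1 := key (min 1 (q / (2 * (|ρ| * Z.card + 1)))) (lt_min one_pos (by positivity))
    (min_le_left _ _)
  have h2 : |ρ| * Z.card * min 1 (q / (2 * (|ρ| * Z.card + 1)))
      ≤ |ρ| * Z.card * (q / (2 * (|ρ| * Z.card + 1))) :=
    mul_le_mul_of_nonneg_left (min_le_right _ _) hB
  have h3 : |ρ| * Z.card * (q / (2 * (|ρ| * Z.card + 1))) < q := by
    rw [← mul_div_assoc, div_lt_iff₀ (by positivity)]
    nlinarith
  linarith

end EdgeFamily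

namespace EdgeFamily

open Finset

/-- A set `s` of `n + 1` elements is the range of exactly `n!` maps `Fin (n + 1) → A` with a
prescribed first value. -/
lemma card_filter_image_eq {A : Type*} [Fintype A] [DecidableEq A] {n : ℕ} {s : Finset A} {v : A}
    (hs : s.card = n + 1) (hv : v ∈ s) :
    (univ.filter fun f : Fin (n + 1) → A => f 0 = v ∧ univ.image f = s).card = n.factorial := by
  have hs' : (s.erase v).card = n := by rw [card_erase_of_mem hv, hs]; rfl
  have e₀ : Fin n ≃ s.erase v := Fintype.equivOfCardEq (by rw [Fintype.card_coe, hs', Fintype.card_fin])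
  rw [show n.factorial = Fintype.card (Fin n ≃ s.erase v) by
    rw [Fintype.card_equiv e₀, Fintype.card_fin], ← card_univ]
  symm
  refine card_bij (fun e _ => Fin.cons v fun t => (e t : A)) ?_ ?_ ?_
  · intro e _
    simp only [mem_filter, mem_univ, true_and, Fin.cons_zero]
    ext a
    simp only [mem_image, mem_univ, true_and, Fin.exists_fin_succ, Fin.cons_zero, Fin.cons_succ]
    constructor
    · rintro (rfl | ⟨t, rfl⟩)
      · exact hv
      · exact mem_of_mem_erase (e t).2
    · intro ha
      by_cases hav : a = v
      · exact Or.inl hav.symm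
      · exact Or.inr ⟨e.symm ⟨a, mem_erase.mpr ⟨hav, ha⟩⟩, by simp⟩
  · intro e _ e' _ h
    ext t
    have := congrFun h t.succ
    simpa using this
  · intro f hf
    obtain ⟨hf0, hfs⟩ := (mem_filter.mp hf).2
    have hinj : Function.Injective f := by
      rw [← Set.injOn_univ, ← coe_univ, ← card_image_iff, hfs, hs, card_univ, Fintype.card_fin]
    have hmem : ∀ t : Fin n, f t.succ ∈ s.erase v := fun t => mem_erase.mpr
      ⟨fun h => Fin.succ_ne_zero t (hinj (h.trans hf0.symm)), hfs ▸ mem_image_of_mem f (mem_univ _)⟩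
    have hbij : Function.Bijective fun t : Fin n => (⟨f t.succ, hmem t⟩ : s.erase v) := by
      rw [Fintype.bijective_iff_injective_and_card]
      refine ⟨fun t t' h => Fin.succ_injective n (hinj (Subtype.ext_iff.mp h)), ?_⟩
      rw [Fintype.card_coe, hs', Fintype.card_fin]
    refine ⟨Equiv.ofBijective _ hbij, mem_univ _, ?_⟩
    ext t
    refine Fin.cases ?_ (fun t => ?_) t
    · simp [hf0]
    · simp

end EdgeFamily

namespace Hypergraph

open Finset EdgeFamily

/-- `E` lists the edges of `H`, without repetition, as sets of elements of the vertex type of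
`H`. -/
structure IsEdgeFamily {V ι : Type*} (H : Hypergraph V) (E : ι → Finset H.vertexSet) : Prop where
  injective : Function.Injective E
  mem_edgeSet_iff : ∀ s : Set H.vertexSet, Subtype.val '' s ∈ H.edgeSet ↔ ∃ i, (E i : Set _) = s

section

variable {V ι : Type*} {H : Hypergraph V} {E : ι → Finset H.vertexSet} {k : ℕ} {α : ℝ}

lemma IsEdgeFamily.exists_eq (hE : H.IsEdgeFamily E) {e : Set V} (he : e ∈ H.edgeSet) :
    ∃ i, Subtype.val '' (E i : Set H.vertexSet) = e := by
  have h : Subtype.val '' (Subtype.val ⁻¹' e : Set H.vertexSet) = e := by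
    rw [Subtype.image_preimage_coe]
    exact Set.inter_eq_right.mpr (H.subset_vertexSet_of_mem_edgeSet he)
  obtain ⟨i, hi⟩ := (hE.mem_edgeSet_iff _).mp (h.symm ▸ he)
  exact ⟨i, by rw [hi, h]⟩

lemma IsEdgeFamily.mem (hE : H.IsEdgeFamily E) (i : ι) :
    Subtype.val '' (E i : Set H.vertexSet) ∈ H.edgeSet :=
  (hE.mem_edgeSet_iff _).mpr ⟨i, rfl⟩

lemma IsEdgeFamily.card_eq (hE : H.IsEdgeFamily E) (hk : H.IsUniform k) (i : ι) :
    (E i).card = k := by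
  have := hk _ (hE.mem i)
  rwa [Set.ncard_image_of_injective _ Subtype.val_injective, Set.ncard_coe_finset] at this

lemma IsEdgeFamily.degree_eq [Fintype ι] [DecidableEq H.vertexSet] (hE : H.IsEdgeFamily E)
    (v : H.vertexSet) : H.degree (v : V) = (univ.filter fun i => v ∈ E i).card := by
  rw [degree, ← Set.ncard_coe_finset]
  symm
  refine Set.ncard_congr (fun i _ => Subtype.val '' (E i : Set H.vertexSet)) ?_ ?_ ?_
  · intro i hi
    exact ⟨hE.mem i, v, by simpa using hi, rfl⟩
  · intro i j _ _ h
    exact hE.injective (coe_injective (Subtype.val_injective.image_injective h))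
  · rintro e ⟨he, hv⟩
    obtain ⟨i, rfl⟩ := hE.exists_eq he
    exact ⟨i, by simpa using hv, rfl⟩

lemma IsEdgeFamily.adjTensor_eq [Fintype ι] [DecidableEq H.vertexSet] (hE : H.IsEdgeFamily E)
    (f : Fin k → H.vertexSet) :
    H.adjTensor k f = ∑ i, if univ.image f = E i then 1 / ((k - 1).factorial : ℝ) else 0 := by
  have h : Set.range (fun t => (f t : V)) = Subtype.val '' (univ.image f : Set H.vertexSet) := by
    rw [coe_image, coe_univ, Set.image_univ, ← Set.range_comp]
    rfl
  unfold adjTensor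
  rw [h, hE.mem_edgeSet_iff]
  split_ifs with hf
  · obtain ⟨i, hi⟩ := hf
    have hi := coe_injective hi
    rw [sum_eq_single i]
    · simp [hi]
    · intro j _ hj
      rw [if_neg]
      intro h'
      exact hj (hE.injective (h'.symm.trans hi.symm))
    · simp
  · symm
    refine sum_eq_zero fun i _ => if_neg fun h' => hf ⟨i, by rw [h']⟩

variable [Fintype ι] [Fintype H.vertexSet] [DecidableEq H.vertexSet] [NeZero k]

/-- The vector `A_α x`: each edge at `v` comes from `(k - 1)!` multi-indices, which cancels the
denominator in the adjacency tensor. -/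
lemma IsEdgeFamily.mulVec_alphaTensor (hE : H.IsEdgeFamily E) (hk : H.IsUniform k)
    (x : H.vertexSet → ℂ) (v : H.vertexSet) :
    HyperTensor.mulVec (H.alphaTensor k α) x v =
      ∑ i with v ∈ E i, ((α : ℂ) * x v ^ (k - 1) + (1 - α) * ∏ w ∈ (E i).erase v, x w) := by
  classical
  obtain ⟨n, rfl⟩ : ∃ n, k = n + 1 := ⟨k - 1, by have := NeZero.ne k; omega⟩
  have hprod : ∀ f : Fin (n + 1) → H.vertexSet, ∏ t ∈ univ.erase (0 : Fin (n + 1)), x (f t) =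
      ∏ t : Fin n, x (f t.succ) := by
    intro f
    rw [show univ.erase (0 : Fin (n + 1)) = univ.image Fin.succ by
      rw [Fin.image_succ_univ]; ext; simp]
    rw [prod_image (Fin.succ_injective n).injOn]
  have hdeg : ∑ f : Fin (n + 1) → H.vertexSet with f 0 = v,
      ((H.degTensor (n + 1) f : ℝ) : ℂ) * ∏ t ∈ univ.erase (0 : Fin (n + 1)), x (f t)
      = (univ.filter fun i => v ∈ E i).card * x v ^ n := by
    rw [sum_eq_single fun _ => v]
    · simp [degTensor, hE.degree_eq]
    · intro f hf hne
      have hf0 := (mem_filter.mp hf).2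
      have : ¬ ∀ t, f t = f 0 := fun h => hne (funext fun t => (h t).trans hf0)
      simp [degTensor, this]
    · simp
  have hadj : ∑ f : Fin (n + 1) → H.vertexSet with f 0 = v,
      ((H.adjTensor (n + 1) f : ℝ) : ℂ) * ∏ t ∈ univ.erase (0 : Fin (n + 1)), x (f t)
      = ∑ i with v ∈ E i, ∏ w ∈ (E i).erase v, x w := by
    simp_rw [hE.adjTensor_eq, Complex.ofReal_sum, sum_mul]
    rw [sum_comm, sum_filter]
    refine sum_congr rfl fun i _ => ?_
    have h1 : ∀ f ∈ univ.filter (fun f : Fin (n + 1) → H.vertexSet => f 0 = v),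
        (((if univ.image f = E i then 1 / ((n + 1 - 1).factorial : ℝ) else 0 : ℝ)) : ℂ) *
          ∏ t ∈ univ.erase (0 : Fin (n + 1)), x (f t) =
        if univ.image f = E i then
          1 / (n.factorial : ℂ) * ∏ w ∈ (E i).erase v, x w else 0 := by
      intro f hf
      have hf0 := (mem_filter.mp hf).2
      split_ifs with h
      · have hinj : Function.Injective f := by
          rw [← Set.injOn_univ, ← coe_univ, ← card_image_iff, h, hE.card_eq hk, card_univ,
            Fintype.card_fin]
        rw [← h, ← hf0, ← image_erase hinj, prod_image (hinj.injOn)]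
        simp
      · simp
    rw [sum_congr rfl h1, ← sum_filter, sum_const, filter_filter]
    split_ifs with hv
    · rw [card_filter_image_eq (hE.card_eq hk i) hv, nsmul_eq_mul, ← mul_assoc, mul_one_div,
        div_self (Nat.cast_ne_zero.mpr n.factorial_ne_zero), one_mul]
    · rw [filter_false_of_mem, card_empty, zero_smul]
      rintro f - ⟨rfl, h⟩
      exact hv (h ▸ mem_image_of_mem f (mem_univ 0))
  unfold HyperTensor.mulVec alphaTensor
  calc _ = ∑ f : Fin (n + 1) → H.vertexSet with f 0 = v,
      ((α : ℂ) * (((H.degTensor (n + 1) f : ℝ) : ℂ) * ∏ t ∈ univ.erase (0 : Fin (n + 1)), x (f t))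
        + (1 - α) * (((H.adjTensor (n + 1) f : ℝ) : ℂ) *
          ∏ t ∈ univ.erase (0 : Fin (n + 1)), x (f t))) := by
        refine sum_congr (by ext; simp) fun f _ => ?_
        push_cast
        ring_nf
    _ = _ := by
        rw [sum_add_distrib, ← mul_sum, ← mul_sum, hdeg, hadj, sum_add_distrib, sum_const,
          nsmul_eq_mul, mul_sum, Nat.add_sub_cancel]
        ring

/-- The maximum of the form relative to `∑ x_v^k` is the spectral radius: a maximizer is an
eigenvector, and for an eigenvector `x` of `μ` the form at `|x|` is at least `|μ| ∑ |x_v|^k`. -/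
lemma IsEdgeFamily.alphaSpectralRadius_eq (hE : H.IsEdgeFamily E) (hH : H.IsUniform k)
    (hk : 2 ≤ k) (hα0 : 0 ≤ α) (hα1 : α ≤ 1) {ρ : ℝ} {x : H.vertexSet → ℝ}
    (hx : IsMaximizer E k α ρ x) : H.alphaSpectralRadius k α = ρ := by
  have hcard := hE.card_eq hH
  have hρ0 : 0 ≤ ρ := by
    have h1 : 0 ≤ form E k α x := sum_nonneg fun i _ => add_nonneg
      (mul_nonneg hα0 (sum_nonneg fun v _ => pow_nonneg (hx.nonneg v) k))
      (mul_nonneg (mul_nonneg (by linarith) (Nat.cast_nonneg k))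
        (prod_nonneg fun v _ => hx.nonneg v))
    rw [hx.eq] at h1
    exact nonneg_of_mul_nonneg_left h1 hx.pos
  have hx0 : x ≠ 0 := by
    rintro rfl
    have := hx.pos
    simp [show k ≠ 0 by omega] at this
  have hmem : ρ ∈ {r : ℝ | ∃ μ : ℂ, HyperTensor.IsEigenvalue (H.alphaTensor k α) μ ∧ r = ‖μ‖} := by
    refine ⟨ρ, ⟨fun v => x v, ?_, fun v => ?_⟩, by simp [abs_of_nonneg hρ0]⟩
    · intro h
      exact hx0 (funext fun v => by simpa using congrFun h v)
    · rw [hE.mulVec_alphaTensor hH]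
      have := hx.apply_eq hk hα1 v
      unfold EdgeFamily.apply at this
      have := congrArg (fun r : ℝ => (r : ℂ)) this
      push_cast at this
      exact this
  have hle : ∀ r ∈ {r : ℝ | ∃ μ : ℂ, HyperTensor.IsEigenvalue (H.alphaTensor k α) μ ∧ r = ‖μ‖},
      r ≤ ρ := by
    rintro r ⟨μ, ⟨z, hz0, hz⟩, rfl⟩
    set y : H.vertexSet → ℝ := fun v => ‖z v‖ with hy
    have hy0 : 0 ≤ y := fun v => norm_nonneg _
    have hyne : y ≠ 0 := fun h => hz0 (funext fun v => norm_eq_zero.mp (congrFun h v))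
    have h1 : ∀ v, ‖μ‖ * y v ^ (k - 1) ≤ EdgeFamily.apply E k α y v := by
      intro v
      have := hz v
      rw [hE.mulVec_alphaTensor hH] at this
      rw [hy, ← norm_pow, ← norm_mul, ← this]
      refine (norm_sum_le _ _).trans (sum_le_sum fun i _ => (norm_add_le _ _).trans ?_)
      have h1α : ‖(1 : ℂ) - α‖ = 1 - α := by
        rw [← Complex.ofReal_one, ← Complex.ofReal_sub, Complex.norm_real, Real.norm_eq_abs,
          abs_of_nonneg (by linarith)]
      rw [norm_mul, norm_mul, h1α, norm_prod, norm_pow, Complex.norm_real, Real.norm_eq_abs,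
        abs_of_nonneg hα0]
    have h2 : ‖μ‖ * ∑ v, y v ^ k ≤ form E k α y := by
      rw [← sum_mul_apply hcard (by omega), mul_sum]
      refine sum_le_sum fun v _ => ?_
      have := mul_le_mul_of_nonneg_left (h1 v) (hy0 v)
      have hpow : y v ^ k = y v * y v ^ (k - 1) := by
        rw [← pow_succ']; congr 1; omega
      rw [hpow]
      linarith
    exact le_of_mul_le_mul_right (h2.trans (hx.le y hy0)) (sum_pow_pos hy0 hyne)
  have : H.alphaSpectralRadius k α = HyperTensor.spectralRadius (H.alphaTensor k α) := by
    unfold alphaSpectralRadius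
    congr
    exact Subsingleton.elim _ _
  rw [this]
  exact le_antisymm (csSup_le ⟨ρ, hmem⟩ hle) (le_csSup ⟨ρ, hle⟩ hmem)

lemma IsEdgeFamily.exists_isMaximizer [Nonempty H.vertexSet] (hE : H.IsEdgeFamily E)
    (hH : H.IsUniform k) (hk : 2 ≤ k) (hα0 : 0 ≤ α) (hα1 : α ≤ 1) :
    ∃ x, IsMaximizer E k α (H.alphaSpectralRadius k α) x := by
  obtain ⟨ρ, x, hx⟩ := EdgeFamily.exists_isMaximizer (hE.card_eq hH) (NeZero.ne k) α
  exact ⟨x, hE.alphaSpectralRadius_eq hH hk hα0 hα1 hx ▸ hx⟩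

end

end Hypergraph

/-! ### Rooted supertrees -/

namespace SimpleGraph

variable {V : Type*} {G : SimpleGraph V}

lemma IsTree.exists_adj_dist_eq (hG : G.IsTree) {r v : V} (hv : v ≠ r) :
    ∃ w, G.Adj w v ∧ G.dist r v = G.dist r w + 1 := by
  obtain ⟨p, hp⟩ := hG.connected.exists_walk_length_eq_dist r v
  have hnil : ¬ p.Nil := fun h => hv h.eq.symm
  refine ⟨p.penultimate, p.adj_penultimate hnil, ?_⟩
  have h1 : G.dist r p.penultimate ≤ p.dropLast.length := dist_le _
  have h2 : p.dropLast.length + 1 = p.length := by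
    have h3 := congrArg Walk.length (p.concat_dropLast (p.adj_penultimate hnil))
    rwa [Walk.length_concat] at h3
  rcases hG.dist_eq_dist_add_one_of_adj r (p.adj_penultimate hnil) with h | h <;> omega

lemma IsTree.eq_of_adj_of_dist_eq (hG : G.IsTree) {r v w w' : V} (hw : G.Adj w v)
    (hw' : G.Adj w' v) (hd : G.dist r v = G.dist r w + 1) (hd' : G.dist r v = G.dist r w' + 1) :
    w = w' := by
  obtain ⟨p, hp⟩ := hG.connected.exists_walk_length_eq_dist r w
  obtain ⟨q, hq⟩ := hG.connected.exists_walk_length_eq_dist r w'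
  have h1 : (p.concat hw).IsPath := Walk.isPath_of_length_eq_dist _ (by
    rw [Walk.length_concat, hp, hd])
  have h2 : (q.concat hw').IsPath := Walk.isPath_of_length_eq_dist _ (by
    rw [Walk.length_concat, hq, hd'])
  have h := congrArg Subtype.val
    ((hG.isAcyclic.subsingleton_path r v).elim ⟨_, h1⟩ ⟨_, h2⟩)
  have h3 := congrArg Walk.penultimate h
  simpa using h3

end SimpleGraph

/-- A family of edges `E i` arranged as a hypertree with root `z`: `top i` is the vertex of `E i`
closest to the root, each vertex other than `z` is in exactly one `E i` other than as its top
vertex, and `depth i` is the number of edges between the root and `top i`. -/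
structure Rooting {A ι : Type*} (E : ι → Finset A) (z : A) where
  top : ι → A
  depth : ι → ℕ
  top_mem : ∀ i, top i ∈ E i
  exists_parent : ∀ a, a ≠ z → ∃ i, a ∈ E i ∧ a ≠ top i
  parent_unique : ∀ {a i j}, a ∈ E i → a ≠ top i → a ∈ E j → a ≠ top j → i = j
  top_eq_root : ∀ {i}, z ∈ E i → top i = z
  depth_eq_zero : ∀ {i}, top i = z → depth i = 0
  depth_succ : ∀ {i j}, top j ∈ E i → top j ≠ top i → depth j = depth i + 1

namespace Hypergraph

variable {V : Type*} (H : Hypergraph V) [Finite H.vertexSet]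

/-- The edge `e` as a finite set of elements of the vertex type of `H`. -/
noncomputable def edgeFinset (e : H.edgeSet) : Finset H.vertexSet :=
  (Set.toFinite (Subtype.val ⁻¹' (e : Set V))).toFinset

variable {H}

@[simp]
lemma mem_edgeFinset {e : H.edgeSet} {v : H.vertexSet} :
    v ∈ H.edgeFinset e ↔ (v : V) ∈ (e : Set V) := by
  simp [edgeFinset]

lemma coe_edgeFinset (e : H.edgeSet) :
    (H.edgeFinset e : Set H.vertexSet) = Subtype.val ⁻¹' (e : Set V) := by
  ext; simp

lemma image_edgeFinset (e : H.edgeSet) :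
    Subtype.val '' (H.edgeFinset e : Set H.vertexSet) = (e : Set V) := by
  rw [coe_edgeFinset, Subtype.image_preimage_coe]
  exact Set.inter_eq_right.mpr (H.subset_vertexSet_of_mem_edgeSet e.2)

variable (H) in
lemma isEdgeFamily_edgeFinset : H.IsEdgeFamily H.edgeFinset where
  injective e f h := by
    rw [Subtype.ext_iff, ← image_edgeFinset, ← image_edgeFinset, h]
  mem_edgeSet_iff s := by
    constructor
    · intro hs
      exact ⟨⟨_, hs⟩, by
        rw [coe_edgeFinset, Set.preimage_image_eq _ Subtype.val_injective]⟩
    · rintro ⟨e, rfl⟩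
      rw [image_edgeFinset]
      exact e.2

/-- A supertree can be rooted at each of its vertices. -/
lemma IsSupertree.nonempty_rooting (hH : H.IsSupertree) (z : H.vertexSet) :
    Nonempty (Rooting H.edgeFinset z) := by
  have hT : H.incidenceGraph.IsTree := ⟨hH.1, hH.2⟩
  set D : H.vertexSet ⊕ H.edgeSet → ℕ := H.incidenceGraph.dist (Sum.inl z) with hD
  have hadj : ∀ (v : H.vertexSet) (e : H.edgeSet), v ∈ H.edgeFinset e →
      H.incidenceGraph.Adj (Sum.inl v) (Sum.inr e) := fun v e h => mem_edgeFinset.mp h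
  have htop : ∀ e : H.edgeSet, ∃ v, v ∈ H.edgeFinset e ∧ D (Sum.inr e) = D (Sum.inl v) + 1 := by
    intro e
    obtain ⟨v | f, hw, hd⟩ := hT.exists_adj_dist_eq (r := Sum.inl z) (v := Sum.inr e) (by simp)
    · exact ⟨v, mem_edgeFinset.mpr hw, hd⟩
    · exact hw.elim
  choose top htop hdtop using htop
  have hchild : ∀ e v, v ∈ H.edgeFinset e → v ≠ top e → D (Sum.inl v) = D (Sum.inr e) + 1 := by
    intro e v hv hne
    rcases hT.dist_eq_dist_add_one_of_adj (Sum.inl z) (hadj v e hv) with h | h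
    · exact h
    · exact absurd (Sum.inl_injective (hT.eq_of_adj_of_dist_eq (hadj v e hv)
        (hadj _ e (htop e)) h (hdtop e))) hne
  have hz : D (Sum.inl z) = 0 := SimpleGraph.dist_self
  refine ⟨⟨top, fun e => D (Sum.inr e) / 2, htop, ?_, ?_, ?_, ?_, ?_⟩⟩
  · intro a ha
    obtain ⟨v | e, hw, hd⟩ := hT.exists_adj_dist_eq (r := Sum.inl z) (v := Sum.inl a)
      (by simpa using ha)
    · exact hw.elim
    · refine ⟨e, mem_edgeFinset.mpr hw, ?_⟩
      rintro rfl
      have := hdtop e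
      simp only [← hD] at hd
      omega
  · intro a e f hae hane haf hanf
    exact Sum.inr_injective (hT.eq_of_adj_of_dist_eq (hadj a e hae).symm (hadj a f haf).symm
      (hchild e a hae hane) (hchild f a haf hanf))
  · intro e he
    by_contra hne
    have := hchild e z he (Ne.symm hne)
    omega
  · intro e he
    have := hdtop e
    rw [he, hz] at this
    omega
  · intro e f h hne
    have h1 := hchild e _ h hne
    have h2 := hdtop f
    omega

end Hypergraph

/-! ### Branching of supertrees that are not caterpillars -/

namespace EdgeFamily

variable {A ι : Type*}

/-- The vertex `v` of `E i` lies in another edge. -/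
def Shared (E : ι → Finset A) (i : ι) (v : A) : Prop :=
  v ∈ E i ∧ ∃ j ≠ i, v ∈ E j

/-- At least two vertices of `E i` lie in other edges. -/
def Nonpendant (E : ι → Finset A) (i : ι) : Prop :=
  ∃ v w, v ≠ w ∧ Shared E i v ∧ Shared E i w

/-- Three edges that are not pendant meet in a vertex. -/
def HasBranchVertex (E : ι → Finset A) : Prop :=
  ∃ v f₁ f₂ f₃, f₁ ≠ f₂ ∧ f₁ ≠ f₃ ∧ f₂ ≠ f₃ ∧ v ∈ E f₁ ∧ v ∈ E f₂ ∧ v ∈ E f₃ ∧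
    Nonpendant E f₁ ∧ Nonpendant E f₂ ∧ Nonpendant E f₃

/-- Three vertices of an edge lie in other edges that are not pendant. -/
def HasBranchEdge (E : ι → Finset A) : Prop :=
  ∃ e v₁ v₂ v₃ f₁ f₂ f₃, v₁ ≠ v₂ ∧ v₁ ≠ v₃ ∧ v₂ ≠ v₃ ∧ v₁ ∈ E e ∧ v₂ ∈ E e ∧ v₃ ∈ E e ∧
    f₁ ≠ e ∧ f₂ ≠ e ∧ f₃ ≠ e ∧ v₁ ∈ E f₁ ∧ v₂ ∈ E f₂ ∧ v₃ ∈ E f₃ ∧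
    Nonpendant E f₁ ∧ Nonpendant E f₂ ∧ Nonpendant E f₃

lemma Nonpendant.exists_ne {E : ι → Finset A} {i : ι} (h : Nonpendant E i) (v : A) :
    ∃ w ∈ E i, w ≠ v ∧ ∃ j ≠ i, w ∈ E j := by
  obtain ⟨a, b, hab, ⟨ha, ha'⟩, hb, hb'⟩ := h
  by_cases h : a = v
  · exact ⟨b, hb, fun hbv => hab (h.trans hbv.symm), hb'⟩
  · exact ⟨a, ha, h, ha'⟩

end EdgeFamily

namespace Rooting

open EdgeFamily

variable {A ι : Type*} {E : ι → Finset A} {z : A} (R : Rooting E z)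

lemma exists_parent_edge {i : ι} (hi : R.top i ≠ z) :
    ∃ p, R.top i ∈ E p ∧ R.top i ≠ R.top p ∧ R.depth i = R.depth p + 1 := by
  obtain ⟨p, hp, hne⟩ := R.exists_parent _ hi
  exact ⟨p, hp, hne, R.depth_succ hp hne⟩

lemma top_eq_of_mem {i j : ι} {a : A} (hij : i ≠ j) (ha : a ∈ E i) (hai : a ≠ R.top i)
    (haj : a ∈ E j) : R.top j = a := by
  by_contra h
  exact hij (R.parent_unique ha hai haj (Ne.symm h))

lemma depth_eq_of_top_eq {i j : ι} (h : R.top i = R.top j) : R.depth i = R.depth j := by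
  by_cases hz : R.top i = z
  · rw [R.depth_eq_zero hz, R.depth_eq_zero (h ▸ hz)]
  · obtain ⟨p, hp, hne, hd⟩ := R.exists_parent_edge hz
    rw [hd, R.depth_succ (i := p) (j := j) (by rwa [← h]) (by rwa [← h])]

lemma ne_of_depth_ne {i j : ι} (h : R.depth i ≠ R.depth j) : i ≠ j := fun h' => h (h' ▸ rfl)

/-- If `a` is in two edges, they are siblings at `a`, or one hangs from the other at `a`. -/
lemma trichotomy {i j : ι} {a : A} (hij : i ≠ j) (hi : a ∈ E i) (hj : a ∈ E j) :
    (R.top i = a ∧ R.top j = a ∧ R.depth i = R.depth j) ∨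
      (R.top j = a ∧ R.top i ≠ a ∧ R.depth j = R.depth i + 1) ∨
      (R.top i = a ∧ R.top j ≠ a ∧ R.depth i = R.depth j + 1) := by
  by_cases h1 : R.top i = a
  · by_cases h2 : R.top j = a
    · exact Or.inl ⟨h1, h2, R.depth_eq_of_top_eq (h1.trans h2.symm)⟩
    · refine Or.inr (Or.inr ⟨h1, h2, R.depth_succ (h1 ▸ hj) ?_⟩)
      rw [h1]; exact Ne.symm h2
  · have h2 := R.top_eq_of_mem hij hi (Ne.symm h1) hj
    refine Or.inr (Or.inl ⟨h2, h1, R.depth_succ (h2 ▸ hi) ?_⟩)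
    rw [h2]; exact Ne.symm h1

/-- Without branching, the edges that are not pendant form a path. Seen from a vertex of an
outermost such edge, every such edge has at most one such edge hanging from it, so that these edges
are ordered by their depth. -/
theorem exists_path [Finite ι] (hR : ∀ z, Nonempty (Rooting E z)) (hA : ¬ HasBranchVertex E)
    (hB : ¬ HasBranchEdge E) :
    ∃ (d : ℕ) (e : Fin d → ι), Function.Injective e ∧ Set.range e = {i | Nonpendant E i} ∧
      (∀ i j : Fin d, (j : ℕ) = i + 1 → ∃ v, ∀ a, a ∈ E (e i) ∧ a ∈ E (e j) ↔ a = v) ∧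
      (∀ i j : Fin d, (i : ℕ) + 1 < j → ∀ a, a ∈ E (e i) → a ∉ E (e j)) := by
  classical
  by_cases hne : ∃ i, Nonpendant E i
  swap
  · push Not at hne
    refine ⟨0, Fin.elim0, fun i => i.elim0, ?_, fun i => i.elim0, fun i => i.elim0⟩
    ext i
    simpa using hne i
  obtain ⟨i₀, hi₀⟩ := hne
  obtain ⟨z₀, -, -, -⟩ := id hi₀
  obtain ⟨R₀⟩ := hR z₀
  -- A deepest non-pendant edge `s` meets other non-pendant edges only at its top vertex; the new
  -- root `r` is another vertex of `s`.
  obtain ⟨s, hs, hmax⟩ := Set.exists_max_image {i | Nonpendant E i} R₀.depth (Set.toFinite _)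
    ⟨i₀, hi₀⟩
  obtain ⟨r, hrs, hrt, -⟩ := hs.exists_ne (R₀.top s)
  have hmeet : ∀ f, Nonpendant E f → f ≠ s → ∀ a, a ∈ E s → a ∈ E f → a = R₀.top s := by
    intro f hf hfs a has haf
    by_contra hat
    rcases R₀.trichotomy hfs.symm has haf with ⟨h, -⟩ | ⟨-, -, h⟩ | ⟨h, -⟩
    · exact hat h.symm
    · have := hmax f hf
      omega
    · exact hat h.symm
  obtain ⟨R⟩ := hR r
  have hroot : ∀ f, Nonpendant E f → R.top f = r → f = s := by
    intro f hf hfr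
    by_contra hfs
    have hrf := R.top_mem f
    rw [hfr] at hrf
    exact hrt (hmeet f hf hfs r hrs hrf)
  have hparent : ∀ f, Nonpendant E f → R.top f ≠ r →
      ∃ p, Nonpendant E p ∧ R.top f ∈ E p ∧ R.top f ≠ R.top p ∧ R.depth f = R.depth p + 1 := by
    intro f hf hfr
    obtain ⟨p, hp, hpt, hd⟩ := R.exists_parent_edge hfr
    refine ⟨p, ?_, hp, hpt, hd⟩
    by_cases hps : p = s
    · exact hps ▸ hs
    refine ⟨_, _, hpt, ⟨hp, f, R.ne_of_depth_ne (by omega), R.top_mem f⟩, R.top_mem p, ?_⟩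
    by_cases hpr : R.top p = r
    · exact ⟨s, Ne.symm hps, by rwa [hpr]⟩
    · obtain ⟨q, hq, -, hd'⟩ := R.exists_parent_edge hpr
      exact ⟨q, R.ne_of_depth_ne (by omega), hq⟩
  have hinj : ∀ n f f', Nonpendant E f → Nonpendant E f' → R.depth f = n → R.depth f' = n →
      f = f' := by
    intro n
    induction n with
    | zero =>
      have h0 : ∀ f, Nonpendant E f → R.depth f = 0 → f = s := by
        intro f hf hd
        refine hroot f hf ?_
        by_contra h
        obtain ⟨p, -, -, -, hd'⟩ := hparent f hf h
        omega
      intro f f' hf hf' hd hd'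
      rw [h0 f hf hd, h0 f' hf' hd']
    | succ n ih =>
      have h1 : ∀ f, R.depth f = n + 1 → R.top f ≠ r := by
        intro f hd h
        rw [R.depth_eq_zero h] at hd
        omega
      intro f f' hf hf' hd hd'
      by_contra hff
      obtain ⟨p, hp, hfp, hfp', hdp⟩ := hparent f hf (h1 f hd)
      obtain ⟨p', hp', hfp2, hfp2', hdp'⟩ := hparent f' hf' (h1 f' hd')
      obtain rfl := ih p p' hp hp' (by omega) (by omega)
      have hpf : p ≠ f := R.ne_of_depth_ne (by omega)
      have hpf' : p ≠ f' := R.ne_of_depth_ne (by omega)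
      by_cases heq : R.top f = R.top f'
      · exact hA ⟨R.top f, p, f, f', hpf, hpf', hff, hfp, R.top_mem f, heq ▸ R.top_mem f',
          hp, hf, hf'⟩
      by_cases hps : p = s
      · subst hps
        exact heq ((hmeet f hf hpf.symm _ hfp (R.top_mem f)).trans
          (hmeet f' hf' hpf'.symm _ hfp2 (R.top_mem f')).symm)
      · obtain ⟨q, hq, hqp, -, hdq⟩ := hparent p hp fun h => hps (hroot p hp h)
        exact hB ⟨p, R.top p, R.top f, R.top f', q, f, f', hfp'.symm, hfp2'.symm, heq,
          R.top_mem p, hfp, hfp2, R.ne_of_depth_ne (by omega), hpf.symm, hpf'.symm, hqp,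
          R.top_mem f, R.top_mem f', hq, hf, hf'⟩
  have hdown : ∀ n f, Nonpendant E f → R.depth f = n → ∀ l ≤ n, ∃ g, Nonpendant E g ∧
      R.depth g = l := by
    intro n
    induction n with
    | zero => exact fun f hf hd l hl => ⟨f, hf, by omega⟩
    | succ n ih =>
      intro f hf hd l hl
      rcases Nat.of_le_succ hl with hl | rfl
      · obtain ⟨p, hp, -, -, hdp⟩ := hparent f hf fun h => by
          rw [R.depth_eq_zero h] at hd
          omega
        exact ih p hp (by omega) l hl
      · exact ⟨f, hf, hd⟩
  obtain ⟨t, ht, htmax⟩ := Set.exists_max_image {i | Nonpendant E i} R.depth (Set.toFinite _)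
    ⟨i₀, hi₀⟩
  choose e he hed using fun n : Fin (R.depth t + 1) => hdown _ t ht rfl n (Nat.lt_succ_iff.mp n.2)
  have hneq : ∀ i j : Fin (R.depth t + 1), (i : ℕ) < j → e i ≠ e j := fun i j hij =>
    R.ne_of_depth_ne (by rw [hed, hed]; omega)
  refine ⟨R.depth t + 1, e, ?_, ?_, ?_, ?_⟩
  · intro i j hij
    have := congrArg R.depth hij
    rw [hed, hed] at this
    exact Fin.ext this
  · ext f
    constructor
    · rintro ⟨i, rfl⟩
      exact he i
    · intro hf
      have hlt : R.depth f < R.depth t + 1 := Nat.lt_succ_iff.mpr (htmax f hf)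
      exact ⟨⟨R.depth f, hlt⟩, hinj _ _ _ (he _) hf (hed _) rfl⟩
  · intro i j hij
    obtain ⟨p, hp, htp, -, hdp⟩ := hparent (e j) (he j) fun h => by
      have := R.depth_eq_zero h
      rw [hed] at this
      omega
    obtain rfl : p = e i := hinj i _ _ hp (he i) (by rw [hed] at hdp; omega) (hed i)
    refine ⟨R.top (e j), fun a => ⟨?_, ?_⟩⟩
    · rintro ⟨hai, haj⟩
      have h1 := hed i
      have h2 := hed j
      rcases R.trichotomy (hneq i j (by omega)) hai haj with ⟨-, h, -⟩ | ⟨h, -⟩ | ⟨-, -, h⟩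
      · exact h.symm
      · exact h.symm
      · omega
    · rintro rfl
      exact ⟨htp, R.top_mem _⟩
  · intro i j hij a hai haj
    have h1 := hed i
    have h2 := hed j
    rcases R.trichotomy (hneq i j (by omega)) hai haj with ⟨-, -, h⟩ | ⟨-, -, h⟩ | ⟨-, -, h⟩ <;>
      omega

end Rooting

namespace Hypergraph

open EdgeFamily

variable {V : Type*} {H : Hypergraph V} [Finite H.vertexSet]

lemma nonpendant_iff (e : H.edgeSet) :
    Nonpendant H.edgeFinset e ↔ ¬ H.IsPendantEdge (e : Set V) := by
  classical
  have : Fintype H.vertexSet := Fintype.ofFinite _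
  have : Finite H.edgeSet := Finite.of_injective _ H.isEdgeFamily_edgeFinset.injective
  have : Fintype H.edgeSet := Fintype.ofFinite _
  have hdeg : ∀ v : H.vertexSet, v ∈ H.edgeFinset e →
      ((∃ f ≠ e, v ∈ H.edgeFinset f) ↔ H.degree (v : V) ≠ 1) := by
    intro v hv
    rw [H.isEdgeFamily_edgeFinset.degree_eq]
    constructor
    · rintro ⟨f, hfe, hf⟩ h
      obtain ⟨g, hg⟩ := Finset.card_eq_one.mp h
      have h1 : e ∈ ({g} : Finset _) := hg ▸ by simpa using hv
      have h2 : f ∈ ({g} : Finset _) := hg ▸ by simpa using hf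
      rw [Finset.mem_singleton] at h1 h2
      exact hfe (h2.trans h1.symm)
    · intro h
      by_contra! hall
      apply h
      rw [Finset.card_eq_one]
      refine ⟨e, ?_⟩
      ext f
      simp only [Finset.mem_filter, Finset.mem_univ, true_and, Finset.mem_singleton]
      refine ⟨fun hf => ?_, fun hf => hf ▸ hv⟩
      by_contra hne
      exact hall f hne hf
  unfold IsPendantEdge Nonpendant Shared
  simp only [e.2, true_and, Set.Subsingleton, not_forall]
  constructor
  · rintro ⟨v, w, hvw, ⟨hv, hv'⟩, hw, hw'⟩
    exact ⟨v, ⟨by simpa using hv, (hdeg v hv).mp hv'⟩, w, ⟨by simpa using hw, (hdeg w hw).mp hw'⟩,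
      fun h => hvw (Subtype.ext h)⟩
  · rintro ⟨v, ⟨hv, hv'⟩, w, ⟨hw, hw'⟩, hvw⟩
    have hsub := H.subset_vertexSet_of_mem_edgeSet e.2
    have hv1 : (⟨v, hsub hv⟩ : H.vertexSet) ∈ H.edgeFinset e := by simpa using hv
    have hw1 : (⟨w, hsub hw⟩ : H.vertexSet) ∈ H.edgeFinset e := by simpa using hw
    exact ⟨⟨v, hsub hv⟩, ⟨w, hsub hw⟩, fun h => hvw (Subtype.ext_iff.mp h),
      ⟨hv1, (hdeg _ hv1).mpr hv'⟩, hw1, (hdeg _ hw1).mpr hw'⟩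

/-- Three non-pendant edges of a supertree that is not a caterpillar meet in a vertex or in vertices
of another edge. -/
theorem IsSupertree.hasBranch_of_not_isCaterpillar (hH : H.IsSupertree) (hc : ¬ H.IsCaterpillar) :
    HasBranchVertex H.edgeFinset ∨ HasBranchEdge H.edgeFinset := by
  by_contra! h
  have : Finite H.edgeSet := Finite.of_injective _ H.isEdgeFamily_edgeFinset.injective
  obtain ⟨d, e, hinj, hrange, hcons, hdisj⟩ := Rooting.exists_path hH.nonempty_rooting h.1 h.2
  refine hc ⟨hH, d, fun i => e i, Subtype.val_injective.comp hinj, ?_, ?_, ?_⟩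
  · ext s
    constructor
    · rintro ⟨i, rfl⟩
      refine ⟨(e i).2, (nonpendant_iff (e i)).mp ?_⟩
      have : e i ∈ Set.range e := ⟨i, rfl⟩
      rwa [hrange] at this
    · rintro ⟨hs, hs'⟩
      have : (⟨s, hs⟩ : H.edgeSet) ∈ Set.range e := by
        rw [hrange]
        exact (nonpendant_iff ⟨s, hs⟩).mpr hs'
      obtain ⟨i, hi⟩ := this
      exact ⟨i, by simp only [hi]⟩
  · intro i j hij
    obtain ⟨v, hv⟩ := hcons i j hij
    refine ⟨v, Set.ext fun a => ⟨fun ⟨hai, haj⟩ => ?_, ?_⟩⟩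
    · have ha := H.subset_vertexSet_of_mem_edgeSet (e i).2 hai
      exact Subtype.ext_iff.mp
        ((hv ⟨a, ha⟩).mp ⟨mem_edgeFinset.mpr hai, mem_edgeFinset.mpr haj⟩)
    · rintro rfl
      obtain ⟨h1, h2⟩ := (hv v).mpr rfl
      exact ⟨mem_edgeFinset.mp h1, mem_edgeFinset.mp h2⟩
  · intro i j hij
    rw [Set.disjoint_left]
    intro a hai haj
    have ha := H.subset_vertexSet_of_mem_edgeSet (e i).2 hai
    exact hdisj i j hij ⟨a, ha⟩ (mem_edgeFinset.mpr hai) (mem_edgeFinset.mpr haj)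

end Hypergraph

/-! ### Moving edges to a vertex of maximal weight -/

namespace EdgeFamily

open Finset

variable {A ι : Type*} [Fintype A] [Fintype ι] [DecidableEq A] {E E' : ι → Finset A} {k : ℕ}
  {α ρ ρ' : ℝ} {x : A → ℝ} {z : A}

omit [Fintype A] in
lemma edgeForm_le_of_shift {s : Finset A} {t : A} (hα0 : 0 ≤ α) (hα1 : α ≤ 1)
    (hpos : ∀ v, 0 < x v) (hmax : ∀ v, x v ≤ x z) (hz : z ∉ s) (ht : t ∈ s) :
    edgeForm k α s x ≤ edgeForm k α (insert z (s.erase t)) x := by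
  have hz' : z ∉ s.erase t := fun h => hz (mem_of_mem_erase h)
  unfold edgeForm
  rw [sum_insert hz', prod_insert hz', ← add_sum_erase _ _ ht, ← mul_prod_erase _ _ ht]
  have h1 : x t ^ k ≤ x z ^ k := pow_le_pow_left₀ (hpos t).le (hmax t) k
  have h2 : 0 ≤ ∏ v ∈ s.erase t, x v := prod_nonneg fun v _ => (hpos v).le
  have h3 : 0 ≤ (1 - α) * k := mul_nonneg (by linarith) (Nat.cast_nonneg k)
  have h4 := hmax t
  gcongr

/-- Moving edges to a vertex `z` of maximal weight does not decrease the spectral radius, and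
leaves it unchanged only if no edge is moved: otherwise the eigenvalue equation at `z` would gain a
positive term. -/
theorem IsMaximizer.le_of_shift (hx : IsMaximizer E k α ρ x) (hk : 2 ≤ k) (hα0 : 0 ≤ α)
    (hα1 : α < 1) (hpos : ∀ v, 0 < x v) (hmax : ∀ v, x v ≤ x z)
    (hE' : ∀ i, E' i = E i ∨ (z ∉ E i ∧ ∃ t ∈ E i, E' i = insert z ((E i).erase t)))
    (hle : FormLE E' k α ρ') : ρ ≤ ρ' ∧ (ρ = ρ' → E' = E) := by
  have hform : form E k α x ≤ form E' k α x := by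
    refine sum_le_sum fun i _ => ?_
    rcases hE' i with h | ⟨hz, t, ht, h⟩
    · rw [h]
    · rw [h]
      exact edgeForm_le_of_shift hα0 hα1.le hpos hmax hz ht
  have hle' := hform.trans (hle x hx.nonneg)
  rw [hx.eq] at hle'
  refine ⟨le_of_mul_le_mul_right hle' hx.pos, ?_⟩
  rintro rfl
  have hx' : IsMaximizer E' k α ρ x :=
    ⟨hle, hx.nonneg, hx.pos, le_antisymm (hle x hx.nonneg) (hx.eq ▸ hform)⟩
  have h1 := hx.apply_eq hk hα1.le z
  have h2 := hx'.apply_eq hk hα1.le z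
  rw [← h1] at h2
  have hsame : ∀ i, z ∈ E i → E' i = E i := by
    intro i hi
    rcases hE' i with h | ⟨hz, -⟩
    · exact h
    · exact absurd hi hz
  have hsub : univ.filter (fun i => z ∈ E i) ⊆ univ.filter (fun i => z ∈ E' i) := by
    intro i hi
    rw [mem_filter] at hi ⊢
    exact ⟨hi.1, by rw [hsame i hi.2]; exact hi.2⟩
  by_contra hne
  obtain ⟨i, hi⟩ := Function.ne_iff.mp hne
  obtain ⟨hzi, t, -, hi'⟩ := (hE' i).resolve_left hi
  refine h2.not_gt ?_
  unfold apply
  have hsum : ∑ i with z ∈ E i, (α * x z ^ (k - 1) + (1 - α) * ∏ w ∈ (E i).erase z, x w) =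
      ∑ i with z ∈ E i, (α * x z ^ (k - 1) + (1 - α) * ∏ w ∈ (E' i).erase z, x w) :=
    sum_congr rfl fun i hi => by rw [hsame i (mem_filter.mp hi).2]
  have hterm : ∀ i, 0 < α * x z ^ (k - 1) + (1 - α) * ∏ w ∈ (E' i).erase z, x w := fun i =>
    add_pos_of_nonneg_of_pos (mul_nonneg hα0 (pow_nonneg (hpos z).le _))
      (mul_pos (by linarith) (prod_pos fun w _ => hpos w))
  rw [hsum]
  exact sum_lt_sum_of_subset hsub (i := i) (by simp [hi']) (by simpa using hzi) (hterm i)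
    fun j _ _ => (hterm j).le

/-- A maximizer of a connected family is positive. -/
lemma IsMaximizer.pos_of_rooting (hx : IsMaximizer E k α ρ x) (hE : ∀ i, (E i).card = k)
    (hk : k ≠ 0) (hα0 : 0 ≤ α) (hα1 : α < 1) (hR : ∀ z, Nonempty (Rooting E z)) (v : A) : 0 < x v := by
  have hne : ∃ r, x r ≠ 0 := by
    by_contra! h
    have := hx.pos
    simp [h, hk] at this
  obtain ⟨r, hr⟩ := hne
  obtain ⟨R⟩ := hR r
  have htop : ∀ n i, R.depth i = n → x (R.top i) ≠ 0 := by
    intro n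
    induction n with
    | zero =>
      intro i hi
      by_cases h : R.top i = r
      · rwa [h]
      · obtain ⟨p, -, -, hd⟩ := R.exists_parent_edge h
        omega
    | succ n ih =>
      intro i hi
      by_cases h : R.top i = r
      · rwa [h]
      · obtain ⟨p, hp, -, hd⟩ := R.exists_parent_edge h
        exact fun h0 => ih p (by omega) (hx.eq_zero_of_mem hE hα0 hα1 hp (R.top_mem p) h0)
  refine lt_of_le_of_ne (hx.nonneg v) (Ne.symm ?_)
  by_cases h : v = r
  · rwa [h]
  · obtain ⟨p, hp, -⟩ := R.exists_parent v h
    exact fun h0 => htop _ p rfl (hx.eq_zero_of_mem hE hα0 hα1 hp (R.top_mem p) h0)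

end EdgeFamily

namespace Rooting

open EdgeFamily

variable {A ι : Type*} {E : ι → Finset A} {z : A} (R : Rooting E z)

/-- The edge `g` hangs from the edge `f`. -/
def Child (f g : ι) : Prop := R.top g ∈ E f ∧ R.top g ≠ R.top f

variable {R}

lemma Child.depth_eq {f g : ι} (h : R.Child f g) : R.depth g = R.depth f + 1 :=
  R.depth_succ h.1 h.2

lemma Child.ne {f g : ι} (h : R.Child f g) : f ≠ g := by
  rintro rfl
  exact h.2 rfl

lemma Child.eq {f f' g : ι} (h : R.Child f g) (h' : R.Child f' g) : f = f' :=
  R.parent_unique h.1 h.2 h'.1 h'.2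

lemma exists_child {f : ι} (hf : Nonpendant E f) : ∃ g, R.Child f g := by
  obtain ⟨w, hw, hwt, g, hgf, hg⟩ := hf.exists_ne (R.top f)
  have := R.top_eq_of_mem hgf.symm hw hwt hg
  exact ⟨g, by rwa [this], by rwa [this]⟩

lemma child_of_mem_of_top_ne {f g : ι} {v : A} (hfg : f ≠ g) (hf : v ∈ E f) (hg : v ∈ E g)
    (hv : R.top f ≠ v) : R.Child f g ∧ R.top g = v := by
  have := R.top_eq_of_mem hfg hf (Ne.symm hv) hg
  exact ⟨⟨by rwa [this], by rw [this]; exact Ne.symm hv⟩, this⟩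

variable (R) in
/-- Six distinct edges form three parent-child pairs. -/
def HasThreePairs : Prop :=
  ∃ a : Fin 6 → ι, Function.Injective a ∧ R.Child (a 0) (a 1) ∧ R.Child (a 2) (a 3) ∧
    R.Child (a 4) (a 5)

variable (R) in
/-- Two edges hang from the same vertex of an edge, and each has a further edge hanging from it. -/
def HasFork : Prop :=
  ∃ a : Fin 5 → ι, Function.Injective a ∧ R.Child (a 0) (a 1) ∧ R.Child (a 1) (a 2) ∧
    R.Child (a 0) (a 3) ∧ R.Child (a 3) (a 4) ∧ R.top (a 1) = R.top (a 3)

lemma hasThreePairs_of_child {f₁ g₁ f₂ g₂ f₃ g₃ : ι} (h₁ : R.Child f₁ g₁) (h₂ : R.Child f₂ g₂)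
    (h₃ : R.Child f₃ g₃) (h12 : f₁ ≠ f₂) (h13 : f₁ ≠ f₃) (h23 : f₂ ≠ f₃)
    (hfg : ∀ f ∈ [f₁, f₂, f₃], ∀ g ∈ [g₁, g₂, g₃], f ≠ g) : R.HasThreePairs := by
  refine ⟨![f₁, g₁, f₂, g₂, f₃, g₃], ?_, h₁, h₂, h₃⟩
  have g12 : g₁ ≠ g₂ := fun h => h12 (h₁.eq (h ▸ h₂))
  have g13 : g₁ ≠ g₃ := fun h => h13 (h₁.eq (h ▸ h₃))
  have g23 : g₂ ≠ g₃ := fun h => h23 (h₂.eq (h ▸ h₃))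
  have : [f₁, g₁, f₂, g₂, f₃, g₃].Nodup := by
    simp at hfg
    simp only [List.nodup_cons, List.mem_cons, List.not_mem_nil, not_or]
    grind
  exact List.nodup_ofFn.mp (by simpa [List.ofFn_succ] using this)

/-- If the root lies beyond `f₁`, seen from the branch vertex `v`, then the other two edges hang
from `f₁` at `v`. -/
lemma hasFork_of_branchVertex {v : A} {f₁ f₂ f₃ : ι} (h12 : f₁ ≠ f₂) (h13 : f₁ ≠ f₃)
    (h23 : f₂ ≠ f₃) (h₁ : v ∈ E f₁) (h₂ : v ∈ E f₂) (h₃ : v ∈ E f₃) (hf₂ : Nonpendant E f₂)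
    (hf₃ : Nonpendant E f₃) (hv : R.top f₁ ≠ v) : R.HasFork := by
  obtain ⟨c₂, t₂⟩ := child_of_mem_of_top_ne h12 h₁ h₂ hv
  obtain ⟨c₃, t₃⟩ := child_of_mem_of_top_ne h13 h₁ h₃ hv
  obtain ⟨g₂, hg₂⟩ := R.exists_child hf₂
  obtain ⟨g₃, hg₃⟩ := R.exists_child hf₃
  refine ⟨![f₁, f₂, g₂, f₃, g₃], ?_, c₂, hg₂, c₃, hg₃, t₂.trans t₃.symm⟩
  have d₂ := c₂.depth_eq
  have d₃ := c₃.depth_eq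
  have e₂ := hg₂.depth_eq
  have e₃ := hg₃.depth_eq
  have g23 : g₂ ≠ g₃ := fun h => h23 (hg₂.eq (h ▸ hg₃))
  have : [f₁, f₂, g₂, f₃, g₃].Nodup := by
    simp only [List.nodup_cons, List.mem_cons, List.not_mem_nil, not_or]
    grind
  exact List.nodup_ofFn.mp (by simpa [List.ofFn_succ] using this)

/-- If the root lies beyond `f₁`, seen from the branch edge `e`, then `e` hangs from `f₁`, and this
is one of the pairs. -/
lemma hasThreePairs_of_branchEdge {e : ι} {v₁ v₂ v₃ : A} {f₁ f₂ f₃ : ι} (h12 : v₁ ≠ v₂)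
    (h13 : v₁ ≠ v₃) (h23 : v₂ ≠ v₃) (he₁ : v₁ ∈ E e) (he₂ : v₂ ∈ E e) (he₃ : v₃ ∈ E e)
    (hn₁ : f₁ ≠ e) (hn₂ : f₂ ≠ e) (hn₃ : f₃ ≠ e) (h₁ : v₁ ∈ E f₁) (h₂ : v₂ ∈ E f₂)
    (h₃ : v₃ ∈ E f₃) (hf₂ : Nonpendant E f₂) (hf₃ : Nonpendant E f₃) (hv : R.top f₁ ≠ v₁) :
    R.HasThreePairs := by
  obtain ⟨c₁, t₁⟩ := child_of_mem_of_top_ne hn₁ h₁ he₁ hv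
  obtain ⟨c₂, t₂⟩ := child_of_mem_of_top_ne hn₂.symm he₂ h₂ (by rwa [t₁])
  obtain ⟨c₃, t₃⟩ := child_of_mem_of_top_ne hn₃.symm he₃ h₃ (by rwa [t₁])
  obtain ⟨g₂, hg₂⟩ := R.exists_child hf₂
  obtain ⟨g₃, hg₃⟩ := R.exists_child hf₃
  have d₁ := c₁.depth_eq
  have d₂ := c₂.depth_eq
  have d₃ := c₃.depth_eq
  have e₂ := hg₂.depth_eq
  have e₃ := hg₃.depth_eq
  refine hasThreePairs_of_child c₁ hg₂ hg₃ (R.ne_of_depth_ne (by omega))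
    (R.ne_of_depth_ne (by omega)) (fun h => h23 (by rw [← t₂, ← t₃, h])) ?_
  simp
  refine ⟨⟨?_, ?_, ?_⟩, ⟨?_, ?_, ?_⟩, ?_, ?_, ?_⟩ <;> first
    | exact hn₁
    | exact R.ne_of_depth_ne (by omega)

/-- The two ways in which the branching of a hypertree that is not a caterpillar can lie with
respect to a root. -/
theorem hasThreePairs_or_hasFork (R : Rooting E z) (h : HasBranchVertex E ∨ HasBranchEdge E) :
    R.HasThreePairs ∨ R.HasFork := by
  rcases h with ⟨v, f₁, f₂, f₃, h12, h13, h23, h₁, h₂, h₃, hf₁, hf₂, hf₃⟩ |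
    ⟨e, v₁, v₂, v₃, f₁, f₂, f₃, h12, h13, h23, he₁, he₂, he₃, hn₁, hn₂, hn₃, h₁, h₂, h₃,
      hf₁, hf₂, hf₃⟩
  · by_cases t₁ : R.top f₁ = v
    swap
    · exact Or.inr (hasFork_of_branchVertex h12 h13 h23 h₁ h₂ h₃ hf₂ hf₃ t₁)
    by_cases t₂ : R.top f₂ = v
    swap
    · exact Or.inr (hasFork_of_branchVertex h12.symm h23 h13 h₂ h₁ h₃ hf₁ hf₃ t₂)
    by_cases t₃ : R.top f₃ = v
    swap
    · exact Or.inr (hasFork_of_branchVertex h13.symm h23.symm h12 h₃ h₁ h₂ hf₁ hf₂ t₃)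
    obtain ⟨g₁, hg₁⟩ := R.exists_child hf₁
    obtain ⟨g₂, hg₂⟩ := R.exists_child hf₂
    obtain ⟨g₃, hg₃⟩ := R.exists_child hf₃
    refine Or.inl (hasThreePairs_of_child hg₁ hg₂ hg₃ h12 h13 h23 ?_)
    intro f hf g hg
    have hf : R.top f = v := by
      simp at hf; rcases hf with rfl | rfl | rfl <;> assumption
    have hg : R.top g ≠ v := by
      simp at hg
      rcases hg with rfl | rfl | rfl
      · exact t₁ ▸ hg₁.2
      · exact t₂ ▸ hg₂.2
      · exact t₃ ▸ hg₃.2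
    rintro rfl
    exact hg hf
  · left
    by_cases t₁ : R.top f₁ = v₁
    swap
    · exact hasThreePairs_of_branchEdge h12 h13 h23 he₁ he₂ he₃ hn₁ hn₂ hn₃ h₁ h₂ h₃ hf₂ hf₃ t₁
    by_cases t₂ : R.top f₂ = v₂
    swap
    · exact hasThreePairs_of_branchEdge h12.symm h23 h13 he₂ he₁ he₃ hn₂ hn₁ hn₃ h₂ h₁ h₃
        hf₁ hf₃ t₂
    by_cases t₃ : R.top f₃ = v₃
    swap
    · exact hasThreePairs_of_branchEdge h13.symm h23.symm h12 he₃ he₁ he₂ hn₃ hn₁ hn₂ h₃ h₁ h₂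
        hf₁ hf₂ t₃
    obtain ⟨g₁, hg₁⟩ := R.exists_child hf₁
    obtain ⟨g₂, hg₂⟩ := R.exists_child hf₂
    obtain ⟨g₃, hg₃⟩ := R.exists_child hf₃
    have htop : ∀ f ∈ [f₁, f₂, f₃], f ≠ e ∧ R.top f ∈ E e := by
      simp [t₁, t₂, t₃, hn₁, hn₂, hn₃, he₁, he₂, he₃]
    -- If `f'` hung from `f`, its top vertex would be in `f` and `e`, so `e` would hang from `f`; but
    -- the top vertex of `f` is in `e`.
    have hno : ∀ f ∈ [f₁, f₂, f₃], ∀ f' ∈ [f₁, f₂, f₃], ¬ R.Child f f' := by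
      intro f hf f' hf' hc
      obtain ⟨c, t⟩ := child_of_mem_of_top_ne (htop f hf).1 hc.1 (htop f' hf').2 (Ne.symm hc.2)
      have h1 := c.depth_eq
      by_cases hff : R.top f = R.top e
      · have := R.depth_eq_of_top_eq hff
        omega
      · have := R.depth_succ (htop f hf).2 hff
        omega
    have hpar : ∀ g ∈ [g₁, g₂, g₃], ∃ f ∈ [f₁, f₂, f₃], R.Child f g := by
      simp [hg₁, hg₂, hg₃]
    refine hasThreePairs_of_child hg₁ hg₂ hg₃ (fun h => h12 (by rw [← t₁, ← t₂, h]))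
      (fun h => h13 (by rw [← t₁, ← t₃, h])) (fun h => h23 (by rw [← t₂, ← t₃, h])) ?_
    rintro f hf g hg rfl
    obtain ⟨f', hf', hc⟩ := hpar f hg
    exact hno f' hf' f hf hc

end Rooting

/-! ### Hypertrees determined by their branching pattern -/

namespace EdgeFamily

open Finset

/-- The family `E` is a hypertree with a root in which all edges hanging from an edge `i` do so at
one vertex `mark i`. The edge `i` consists of the vertices of `part i`, which are not in an edge
closer to the root, and one more vertex: the root if `p i = none`, and `mark j` if
`p i = some j`. -/
structure Branching {A ι : Type*} (k : ℕ) (E : ι → Finset A) (p : ι → Option ι) where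
  root : A
  part : ι → Finset A
  mark : ι → A
  mark_mem : ∀ i, mark i ∈ part i
  card_part : ∀ i, (part i).card = k - 1
  root_notMem : ∀ i, root ∉ part i
  part_unique : ∀ {a i j}, a ∈ part i → a ∈ part j → i = j
  exists_part : ∀ a, a ≠ root → ∃ i, a ∈ part i
  ne_self : ∀ i, p i ≠ some i
  mem_iff : ∀ i a, a ∈ E i ↔ a = (p i).elim root mark ∨ a ∈ part i

namespace Branching

variable {A B ι κ : Type*} {k : ℕ} {E : ι → Finset A} {p : ι → Option ι} {E' : κ → Finset B}
  {p' : κ → Option κ}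

lemma elim_notMem (T : Branching k E p) (i : ι) : (p i).elim T.root T.mark ∉ T.part i := by
  rcases h : p i with _ | j
  · exact T.root_notMem i
  · intro hmem
    exact T.ne_self i (h.trans (congrArg some (T.part_unique (T.mark_mem j) hmem)))

lemma card_eq (T : Branching k E p) (hk : 1 ≤ k) (i : ι) : (E i).card = k := by
  have : E i = cons _ _ (T.elim_notMem i) := by
    ext a
    rw [T.mem_iff, mem_cons]
  rw [this, card_cons, T.card_part]
  omega

lemma injective (T : Branching k E p) (hk : 3 ≤ k) : Function.Injective E := by
  intro i j hij
  obtain ⟨a, ha, b, hb, hab⟩ := one_lt_card.mp (by rw [T.card_part i]; omega : 1 < (T.part i).card)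
  have h : ∀ c ∈ T.part i, c = (p j).elim T.root T.mark ∨ i = j := by
    intro c hc
    rcases (T.mem_iff j c).mp (hij ▸ (T.mem_iff i c).mpr (Or.inr hc)) with h | h
    · exact Or.inl h
    · exact Or.inr (T.part_unique hc h)
  rcases h a ha with h1 | h1
  · rcases h b hb with h2 | h2
    · exact absurd (h1.trans h2.symm) hab
    · exact h2
  · exact h1

/-- The decomposition of the vertex set into the root and the parts. -/
noncomputable def equiv (T : Branching k E p) : Option (Σ i, T.part i) ≃ A :=
  Equiv.ofBijective (fun o => o.elim T.root fun s => s.2) (by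
    constructor
    · rintro (_ | ⟨i, a, ha⟩) (_ | ⟨j, b, hb⟩) h
      · rfl
      · simp only [Option.elim] at h
        exact absurd hb (h ▸ T.root_notMem j)
      · simp only [Option.elim] at h
        exact absurd ha (h ▸ T.root_notMem i)
      · simp only [Option.elim] at h
        subst h
        obtain rfl := T.part_unique ha hb
        rfl
    · intro a
      by_cases ha : a = T.root
      · exact ⟨none, ha.symm⟩
      · obtain ⟨i, hi⟩ := T.exists_part a ha
        exact ⟨some ⟨i, a, hi⟩, rfl⟩)

@[simp]
lemma equiv_none (T : Branching k E p) : T.equiv none = T.root := rfl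

@[simp]
lemma equiv_some (T : Branching k E p) (s : Σ i, T.part i) : T.equiv (some s) = s.2 := rfl

/-- Hypertrees with the same branching pattern are isomorphic. -/
theorem exists_equiv (T : Branching k E p) (T' : Branching k E' p') (φ : ι ≃ κ)
    (hφ : ∀ i, p' (φ i) = (p i).map φ) :
    ∃ σ : A ≃ B, ∀ i, E' (φ i) = (E i).map σ.toEmbedding := by
  classical
  have hτ : ∀ i, ∃ τ : T.part i ≃ T'.part (φ i), τ ⟨T.mark i, T.mark_mem i⟩ =
      ⟨T'.mark (φ i), T'.mark_mem (φ i)⟩ := fun i =>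
    ⟨(Finset.equivOfCardEq (by rw [T.card_part, T'.card_part])).setValue _ _,
      Equiv.setValue_eq _ _ _⟩
  choose τ hτ using hτ
  set σ : A ≃ B := T.equiv.symm.trans ((Equiv.optionCongr (Equiv.sigmaCongr φ τ)).trans T'.equiv)
    with hσ
  have hroot : σ T.root = T'.root := by
    have : T.equiv.symm T.root = none := by rw [Equiv.symm_apply_eq, equiv_none]
    simp [hσ, this]
  have hpart : ∀ i a (ha : a ∈ T.part i), σ a = τ i ⟨a, ha⟩ := by
    intro i a ha
    have : T.equiv.symm a = some ⟨i, a, ha⟩ := by rw [Equiv.symm_apply_eq, equiv_some]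
    simp only [hσ, Equiv.trans_apply, this]
    rfl
  have hmark : ∀ i, σ (T.mark i) = T'.mark (φ i) := fun i => by
    rw [hpart i _ (T.mark_mem i), hτ]
  have hiff : ∀ i b, σ.symm b ∈ T.part i ↔ b ∈ T'.part (φ i) := by
    intro i b
    constructor
    · intro h
      have := hpart i _ h
      rw [Equiv.apply_symm_apply] at this
      rw [this]
      exact (τ i _).2
    · intro h
      have h1 := hpart i _ ((τ i).symm ⟨b, h⟩).2
      simp only [Subtype.coe_eta, Equiv.apply_symm_apply] at h1
      rw [← h1, Equiv.symm_apply_apply]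
      exact ((τ i).symm ⟨b, h⟩).2
  have hparent : ∀ i, σ ((p i).elim T.root T.mark) = (p' (φ i)).elim T'.root T'.mark := by
    intro i
    rw [hφ]
    rcases p i with _ | j
    · exact hroot
    · exact hmark j
  refine ⟨σ, fun i => ?_⟩
  ext b
  rw [T'.mem_iff, mem_map_equiv, T.mem_iff, hiff, ← hparent, Equiv.symm_apply_eq]

end Branching

/-- The branching pattern `p` is `q`, up to further edges that hang from the root and have nothing
hanging from them. -/
def IsShape {ι : Type*} {n : ℕ} (q : Fin n → Option (Fin n)) (p : ι → Option ι) : Prop :=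
  ∃ a : Fin n → ι, Function.Injective a ∧ (∀ t, p (a t) = (q t).map a) ∧
    ∀ i ∉ Set.range a, p i = none

lemma IsShape.exists_equiv {ι κ : Type*} [Fintype ι] [Fintype κ] {n : ℕ}
    {q : Fin n → Option (Fin n)} {p : ι → Option ι} {p' : κ → Option κ} (h : IsShape q p)
    (h' : IsShape q p') (hcard : Fintype.card ι = Fintype.card κ) :
    ∃ φ : ι ≃ κ, ∀ i, p' (φ i) = (p i).map φ := by
  classical
  obtain ⟨a, ha, hpa, hp⟩ := h
  obtain ⟨b, hb, hpb, hp'⟩ := h'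
  obtain ⟨φ, hφ⟩ : ∃ φ : ι ≃ κ, ∀ t, φ (a t) = b t := by
    -- Any bijection will do after a permutation, as permutations act transitively on injections.
    set e := Fintype.equivOfCardEq hcard
    obtain ⟨g, hg⟩ := (Equiv.Perm.isMultiplyPretransitive κ n).exists_smul_eq
      ⟨fun t => e (a t), e.injective.comp ha⟩ ⟨b, hb⟩
    exact ⟨e.trans g, fun t => DFunLike.congr_fun hg t⟩
  refine ⟨φ, fun i => ?_⟩
  by_cases hi : i ∈ Set.range a
  · obtain ⟨t, rfl⟩ := hi
    rw [hφ, hpb, hpa]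
    rcases q t with _ | s
    · rfl
    · simp [hφ]
  · rw [hp i hi, hp' (φ i)]
    · rfl
    · rintro ⟨t, ht⟩
      exact hi ⟨t, φ.injective ((hφ t).trans ht)⟩

/-- The pattern of a root with three legs of length two. -/
def spiderShape : Fin 6 → Option (Fin 6) := ![none, some 0, none, some 2, none, some 4]

/-- The pattern of a root with one edge, at a further vertex of which two legs of length two are
attached. -/
def forkShape : Fin 5 → Option (Fin 5) := ![none, some 0, some 1, some 0, some 3]

end EdgeFamily

namespace Rooting

open EdgeFamily Finset

variable {A ι : Type*} {E : ι → Finset A} {z : A}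

/-- If parent-child pairs realise the pattern `q`, then moving every edge that is not a child in
these pairs from its top vertex to the root results in a hypertree with pattern `q`. -/
theorem exists_branching [DecidableEq A] (R : Rooting E z) {k n : ℕ} (hk : 2 ≤ k)
    (hE : ∀ i, (E i).card = k) {q : Fin n → Option (Fin n)} {a : Fin n → ι}
    (ha : Function.Injective a) (hchild : ∀ t s, q t = some s → R.Child (a s) (a t))
    (htop : ∀ t t' s, q t = some s → q t' = some s → R.top (a t) = R.top (a t')) :
    ∃ (E' : ι → Finset A) (p : ι → Option ι), IsShape q p ∧ Nonempty (Branching k E' p) ∧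
      ∀ i, E' i = E i ∨ (z ∉ E i ∧ ∃ t ∈ E i, E' i = insert z ((E i).erase t)) := by
  classical
  set p : ι → Option ι := Function.extend a (fun t => (q t).map a) fun _ => none with hp
  have hpa : ∀ t, p (a t) = (q t).map a := fun t => ha.extend_apply _ _ t
  have hpn : ∀ i ∉ Set.range a, p i = none := fun i hi => Function.extend_apply' _ _ _ hi
  have hps : ∀ i j, p i = some j → ∃ t s, a t = i ∧ a s = j ∧ q t = some s := by
    intro i j hij
    by_cases hi : i ∈ Set.range a
    · obtain ⟨t, rfl⟩ := hi
      rw [hpa, Option.map_eq_some_iff] at hij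
      obtain ⟨s, hs, rfl⟩ := hij
      exact ⟨t, s, rfl, rfl, hs⟩
    · rw [hpn i hi] at hij
      exact absurd hij (by simp)
  have hpc : ∀ i j, p i = some j → R.Child j i := by
    intro i j hij
    obtain ⟨t, s, rfl, rfl, hts⟩ := hps i j hij
    exact hchild t s hts
  have hcard : ∀ i, ((E i).erase (R.top i)).card = k - 1 := fun i => by
    rw [card_erase_of_mem (R.top_mem i), hE]
  have hmark : ∀ j, ∃ w ∈ (E j).erase (R.top j), ∀ i, p i = some j → R.top i = w := by
    intro j
    by_cases hj : ∃ i, p i = some j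
    · obtain ⟨i, hi⟩ := hj
      refine ⟨R.top i, mem_erase.mpr ⟨(hpc i j hi).2, (hpc i j hi).1⟩, fun i' hi' => ?_⟩
      obtain ⟨t, s, rfl, rfl, hts⟩ := hps i j hi
      obtain ⟨t', s', rfl, hs', hts'⟩ := hps i' _ hi'
      obtain rfl := ha hs'
      exact htop t' t s' hts' hts
    · obtain ⟨w, hw⟩ : ((E j).erase (R.top j)).Nonempty := card_pos.mp (by rw [hcard]; omega)
      exact ⟨w, hw, fun i hi => absurd ⟨i, hi⟩ hj⟩
  choose mark hmark hmark' using hmark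
  refine ⟨fun i => insert ((p i).elim z mark) ((E i).erase (R.top i)), p, ⟨a, ha, hpa, hpn⟩,
    ⟨⟨z, fun i => (E i).erase (R.top i), mark, hmark, hcard, ?_, ?_, ?_, ?_, ?_⟩⟩, ?_⟩
  · intro i h
    exact (mem_erase.mp h).1 (R.top_eq_root (mem_erase.mp h).2).symm
  · intro v i j hi hj
    exact R.parent_unique (mem_erase.mp hi).2 (mem_erase.mp hi).1 (mem_erase.mp hj).2
      (mem_erase.mp hj).1
  · intro v hv
    obtain ⟨i, hi, hne⟩ := R.exists_parent v hv
    exact ⟨i, mem_erase.mpr ⟨hne, hi⟩⟩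
  · exact fun i hi => (hpc i i hi).ne rfl
  · intro i v
    rw [mem_insert]
  · intro i
    beta_reduce
    rcases h : p i with _ | j
    · by_cases hz : z ∈ E i
      · left
        rw [R.top_eq_root hz]
        exact insert_erase hz
      · exact Or.inr ⟨hz, R.top i, R.top_mem i, rfl⟩
    · left
      rw [Option.elim, ← hmark' j i h, insert_erase (R.top_mem i)]

end Rooting

/-! ### Isomorphic hypergraphs -/

namespace EdgeFamily

open Finset

variable {A B ι κ : Type*} [Fintype A] [Fintype B] [Fintype ι] [Fintype κ] {E : ι → Finset A}
  {E' : κ → Finset B} {k : ℕ} {α ρ : ℝ}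

omit [Fintype A] [Fintype B] in
lemma form_comp_equiv (σ : A ≃ B) (φ : ι ≃ κ) (h : ∀ i, E' (φ i) = (E i).map σ.toEmbedding)
    (y : B → ℝ) : form E' k α y = form E k α (y ∘ σ) := by
  unfold form
  rw [← φ.sum_comp]
  exact sum_congr rfl fun i _ => by simp [edgeForm, h, sum_map, prod_map]

lemma FormLE.of_equiv (hle : FormLE E' k α ρ) (σ : A ≃ B) (φ : ι ≃ κ)
    (h : ∀ i, E' (φ i) = (E i).map σ.toEmbedding) : FormLE E k α ρ := by
  intro y hy
  have h1 := hle (y ∘ σ.symm) fun b => hy (σ.symm b)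
  rw [form_comp_equiv σ φ h, ← σ.sum_comp] at h1
  simpa [Function.comp_def] using h1

lemma IsMaximizer.of_equiv {y : B → ℝ} (hy : IsMaximizer E' k α ρ y) (σ : A ≃ B) (φ : ι ≃ κ)
    (h : ∀ i, E' (φ i) = (E i).map σ.toEmbedding) : IsMaximizer E k α ρ (y ∘ σ) where
  le := hy.le.of_equiv σ φ h
  nonneg := fun a => hy.nonneg (σ a)
  pos := by
    have := hy.pos
    rwa [← σ.sum_comp] at this
  eq := by
    have := hy.eq
    rwa [form_comp_equiv σ φ h, ← σ.sum_comp] at this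

end EdgeFamily

namespace Hypergraph

open EdgeFamily Finset

variable {V W ι κ : Type*} {G : Hypergraph V} {K : Hypergraph W} {E : ι → Finset G.vertexSet}
  {E' : κ → Finset K.vertexSet} {k : ℕ}

lemma IsEdgeFamily.isUniform (hE : G.IsEdgeFamily E) (h : ∀ i, (E i).card = k) :
    G.IsUniform k := by
  intro e he
  obtain ⟨i, rfl⟩ := hE.exists_eq he
  rw [Set.ncard_image_of_injective _ Subtype.val_injective, Set.ncard_coe_finset, h]

lemma IsEdgeFamily.isIsomorphic (hE : G.IsEdgeFamily E) (hE' : K.IsEdgeFamily E')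
    (σ : G.vertexSet ≃ K.vertexSet) (φ : ι ≃ κ)
    (h : ∀ i, E' (φ i) = (E i).map σ.toEmbedding) : G.IsIsomorphic K := by
  refine ⟨σ, fun e => ?_⟩
  rw [hE.mem_edgeSet_iff, hE'.mem_edgeSet_iff, ← φ.exists_congr_right]
  refine exists_congr fun i => ?_
  rw [h, coe_map, Equiv.coe_toEmbedding, σ.injective.image_injective.eq_iff]

lemma IsIsomorphic.isEdgeFamily_map {σ : G.vertexSet ≃ K.vertexSet}
    (hσ : ∀ e : Set G.vertexSet,
      Subtype.val '' e ∈ G.edgeSet ↔ Subtype.val '' (σ '' e) ∈ K.edgeSet)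
    (hE : G.IsEdgeFamily E) : K.IsEdgeFamily fun i => (E i).map σ.toEmbedding where
  injective := (map_injective _).comp hE.injective
  mem_edgeSet_iff s := by
    have h := hσ (σ.symm '' s)
    rw [Equiv.image_symm_image] at h
    rw [← h, hE.mem_edgeSet_iff]
    refine exists_congr fun i => ?_
    rw [coe_map, Equiv.coe_toEmbedding, Equiv.eq_image_iff_symm_image_eq, Equiv.symm_symm]

lemma IsIsomorphic.alphaSpectralRadius_eq [NeZero k] {α : ℝ} [Finite G.vertexSet]
    [Finite K.vertexSet] [Nonempty G.vertexSet] (h : G.IsIsomorphic K) (hG : G.IsUniform k)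
    (hk : 2 ≤ k) (hα0 : 0 ≤ α) (hα1 : α ≤ 1) :
    G.alphaSpectralRadius k α = K.alphaSpectralRadius k α := by
  classical
  have := Fintype.ofFinite G.vertexSet
  have := Fintype.ofFinite K.vertexSet
  have hE := G.isEdgeFamily_edgeFinset
  have : Finite G.edgeSet := Finite.of_injective _ hE.injective
  have := Fintype.ofFinite G.edgeSet
  obtain ⟨σ, hσ⟩ := h
  have hE' := IsIsomorphic.isEdgeFamily_map hσ hE
  have hK : K.IsUniform k := hE'.isUniform fun i => by rw [card_map, hE.card_eq hG]
  have : Nonempty K.vertexSet := ⟨σ (Classical.arbitrary _)⟩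
  obtain ⟨y, hy⟩ := hE'.exists_isMaximizer hK hk hα0 hα1
  exact hE.alphaSpectralRadius_eq hG hk hα0 hα1 (hy.of_equiv σ (Equiv.refl _) fun i => rfl)

/-! ### Powers of rooted trees -/

section Power

variable {T : SimpleGraph W} {r : W} {par : W → W}

/-- The edge of a rooted tree joining a vertex to its parent. -/
def parentEdge (hadj : ∀ a, a ≠ r → T.Adj a (par a)) (a : {a // a ≠ r}) : T.edgeSet :=
  ⟨s(a, par a), hadj a a.2⟩

/-- The vertices of the `k`-th power of a rooted tree that belong to the edge between `a` and its
parent, except for the parent: the new vertices, and `a` itself, which is listed as `none`. -/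
def powerPart (k : ℕ) (hadj : ∀ a, a ≠ r → T.Adj a (par a)) (a : {a // a ≠ r}) :
    Option (Fin (k - 2)) ↪ (power T k).vertexSet where
  toFun o := ⟨o.elim (Sum.inl a) fun j => Sum.inr (parentEdge hadj a, j), Set.mem_univ _⟩
  inj' := by
    rintro (_ | i) (_ | j) h <;> simp at h ⊢
    exact h

/-- The edges of the `k`-th power of a rooted tree, listed by their lower ends in the tree. -/
noncomputable def powerFamily (k : ℕ) (hadj : ∀ a, a ≠ r → T.Adj a (par a)) (a : {a // a ≠ r}) :
    Finset (power T k).vertexSet :=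
  open Classical in
  insert ⟨Sum.inl (par a), Set.mem_univ _⟩ (univ.map (powerPart k hadj a))

lemma parentEdge_surjective (hadj : ∀ a, a ≠ r → T.Adj a (par a))
    (hT : ∀ a b, T.Adj a b → (a ≠ r ∧ par a = b) ∨ (b ≠ r ∧ par b = a)) :
    Function.Surjective (parentEdge hadj) := by
  rintro ⟨e, he⟩
  induction e using Sym2.ind with
  | _ a b =>
    rcases hT a b he with ⟨h, rfl⟩ | ⟨h, rfl⟩
    · exact ⟨⟨a, h⟩, rfl⟩
    · exact ⟨⟨b, h⟩, Subtype.ext Sym2.eq_swap⟩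

lemma mem_powerPart {hadj : ∀ a, a ≠ r → T.Adj a (par a)} {a : {a // a ≠ r}}
    {y : (power T k).vertexSet} : y ∈ univ.map (powerPart k hadj a) ↔
      y.1 = Sum.inl (a : W) ∨ ∃ j, y.1 = Sum.inr (parentEdge hadj a, j) := by
  rw [mem_map]
  constructor
  · rintro ⟨_ | j, -, rfl⟩
    · exact Or.inl rfl
    · exact Or.inr ⟨j, rfl⟩
  · rintro (h | ⟨j, h⟩)
    · exact ⟨none, mem_univ _, Subtype.ext h.symm⟩
    · exact ⟨some j, mem_univ _, Subtype.ext h.symm⟩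

lemma mem_powerFamily {hadj : ∀ a, a ≠ r → T.Adj a (par a)} {a : {a // a ≠ r}}
    {y : (power T k).vertexSet} : y ∈ powerFamily k hadj a ↔
      y.1 = Sum.inl (par a) ∨ y.1 = Sum.inl (a : W) ∨
        ∃ j, y.1 = Sum.inr (parentEdge hadj a, j) := by
  classical
  unfold powerFamily
  rw [mem_insert, mem_powerPart, Subtype.ext_iff]

open Classical in
/-- The branching pattern of a rooted tree, in which a vertex other than the root stands for the
edge to its parent. -/
noncomputable def powerPattern (par : W → W) (r : W) (a : {a // a ≠ r}) : Option {a // a ≠ r} :=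
  if h : par a = r then none else some ⟨par a, h⟩

lemma parentEdge_injective (hadj : ∀ a, a ≠ r → T.Adj a (par a))
    (hpar : ∀ a b, a ≠ r → b ≠ r → par a = b → par b ≠ a) :
    Function.Injective (parentEdge hadj) := by
  intro a b h
  have h := congrArg Subtype.val h
  simp only [parentEdge, Sym2.eq_iff] at h
  rcases h with ⟨h, -⟩ | ⟨h1, h2⟩
  · exact Subtype.ext h
  · exact absurd h1.symm (hpar a b a.2 b.2 h2)

/-- The power of a rooted tree is a hypertree whose marked vertices are the old vertices. -/
lemma nonempty_branching_power (hk : 2 ≤ k) (hadj : ∀ a, a ≠ r → T.Adj a (par a))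
    (hpar : ∀ a b, a ≠ r → b ≠ r → par a = b → par b ≠ a)
    (hT : ∀ a b, T.Adj a b → (a ≠ r ∧ par a = b) ∨ (b ≠ r ∧ par b = a)) :
    Nonempty (Branching k (powerFamily k hadj) (powerPattern par r)) := by
  classical
  have hedge := parentEdge_surjective hadj hT
  refine ⟨⟨⟨Sum.inl r, Set.mem_univ _⟩, fun a => univ.map (powerPart k hadj a),
    fun a => ⟨Sum.inl a, Set.mem_univ _⟩, ?_, ?_, ?_, ?_, ?_, ?_, ?_⟩⟩
  · intro a
    exact mem_map.mpr ⟨none, mem_univ _, rfl⟩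
  · intro a
    rw [card_map, card_univ, Fintype.card_option, Fintype.card_fin]
    omega
  · intro a h
    rcases mem_powerPart.mp h with h | ⟨j, h⟩
    · exact a.2 (Sum.inl_injective h).symm
    · exact Sum.inl_ne_inr h
  · intro y a b ha hb
    rcases mem_powerPart.mp ha with ha | ⟨i, ha⟩ <;> rcases mem_powerPart.mp hb with hb | ⟨j, hb⟩
    · exact Subtype.ext (Sum.inl_injective (ha.symm.trans hb))
    · exact absurd (ha.symm.trans hb) Sum.inl_ne_inr
    · exact absurd (ha.symm.trans hb) Sum.inr_ne_inl
    · exact parentEdge_injective hadj hpar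
        (congrArg Prod.fst (Sum.inr_injective (ha.symm.trans hb)))
  · rintro ⟨b | ⟨e, j⟩, hy⟩ hne
    · have hb : b ≠ r := fun h => hne (by simp [h])
      exact ⟨⟨b, hb⟩, mem_powerPart.mpr (Or.inl rfl)⟩
    · obtain ⟨a, rfl⟩ := hedge e
      exact ⟨a, mem_powerPart.mpr (Or.inr ⟨j, rfl⟩)⟩
  · intro a h
    unfold powerPattern at h
    split_ifs at h with hr
    have h1 : par a = a := congrArg Subtype.val (Option.some_injective _ h)
    exact (hadj a a.2).ne h1.symm
  · intro a y
    unfold powerFamily powerPattern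
    rw [mem_insert]
    split_ifs with hr
    · simp [hr]
    · simp

lemma isEdgeFamily_power (hk : 3 ≤ k) (hadj : ∀ a, a ≠ r → T.Adj a (par a))
    (hpar : ∀ a b, a ≠ r → b ≠ r → par a = b → par b ≠ a)
    (hT : ∀ a b, T.Adj a b → (a ≠ r ∧ par a = b) ∨ (b ≠ r ∧ par b = a)) :
    (power T k).IsEdgeFamily (powerFamily k hadj) := by
  obtain ⟨S⟩ := nonempty_branching_power (k := k) (by omega) hadj hpar hT
  have hedge := parentEdge_surjective hadj hT
  have himage : ∀ a, Subtype.val '' (powerFamily k hadj a : Set (power T k).vertexSet) =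
      Sum.inl '' {v : W | v ∈ (parentEdge hadj a : Sym2 W)} ∪
        Sum.inr '' {p : T.edgeSet × Fin (k - 2) | p.1 = parentEdge hadj a} := by
    intro a
    ext y
    have h1 : y ∈ Subtype.val '' (powerFamily k hadj a : Set (power T k).vertexSet) ↔
        y = Sum.inl (par a) ∨ y = Sum.inl (a : W) ∨
          ∃ j, y = Sum.inr (parentEdge hadj a, j) := by
      constructor
      · rintro ⟨y, hy, rfl⟩
        exact mem_powerFamily.mp hy
      · exact fun h => ⟨⟨y, Set.mem_univ y⟩, mem_powerFamily.mpr h, rfl⟩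
    rw [h1]
    rcases y with b | ⟨e, j⟩
    · simp [parentEdge, or_comm]
    · simp
  refine ⟨S.injective hk, fun s => ?_⟩
  constructor
  · rintro ⟨e, he⟩
    obtain ⟨a, rfl⟩ := hedge e
    exact ⟨a, Subtype.val_injective.image_injective ((himage a).trans he)⟩
  · rintro ⟨a, ha⟩
    rw [← ha, himage]
    exact ⟨_, rfl⟩

end Power

end Hypergraph

/-! ### The extremal hypertrees as hypertrees with a given branching pattern -/

namespace TreeVertex

variable {s t a b : ℕ}

/-- The neighbour of a vertex in the direction of the edge `uv`. The vertices `u` and `v` are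
exchanged, so that this is the parent map both for the root `u` and for the root `v`. -/
def parent : TreeVertex s t a b → TreeVertex s t a b
  | .u => .v
  | .v => .u
  | .leafU _ => .u
  | .leafV _ => .v
  | .pathA i => if (i : ℕ) = 0 then .v else .pathA ⟨i - 1, by omega⟩
  | .pathB i => if (i : ℕ) = 0 then .v else .pathB ⟨i - 1, by omega⟩

lemma parent_eq_of_treeEdge {x y : TreeVertex s t a b} (h : TreeEdge s t a b x y) :
    y.parent = x := by
  cases h with
  | centre => rfl
  | leafU i => rfl
  | leafV i => rfl
  | startA i h => simp [parent, h]
  | startB i h => simp [parent, h]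
  | stepA i j h => simp [parent, h]
  | stepB i j h => simp [parent, h]

lemma adj_parent (x : TreeVertex s t a b) : (treeT s t a b).Adj x x.parent := by
  rw [treeT, SimpleGraph.fromRel_adj]
  cases x with
  | u => exact ⟨by simp [parent], Or.inl .centre⟩
  | v => exact ⟨by simp [parent], Or.inr .centre⟩
  | leafU i => exact ⟨by simp [parent], Or.inr (.leafU i)⟩
  | leafV i => exact ⟨by simp [parent], Or.inr (.leafV i)⟩
  | pathA i =>
    simp only [parent]
    split_ifs with h
    · exact ⟨by simp, Or.inr (.startA i h)⟩
    · exact ⟨by simp [Fin.ext_iff]; omega, Or.inr (.stepA _ i (by simp; omega))⟩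
  | pathB i =>
    simp only [parent]
    split_ifs with h
    · exact ⟨by simp, Or.inr (.startB i h)⟩
    · exact ⟨by simp [Fin.ext_iff]; omega, Or.inr (.stepB _ i (by simp; omega))⟩

lemma parent_of_treeEdge {r x y : TreeVertex s t a b} (hr : r = .u ∨ r = .v)
    (h : TreeEdge s t a b x y) : (x ≠ r ∧ x.parent = y) ∨ (y ≠ r ∧ y.parent = x) := by
  by_cases hy : y = r
  · subst hy
    rcases hr with rfl | rfl
    · cases h
    · cases h
      exact Or.inl ⟨by simp, rfl⟩
  · exact Or.inr ⟨hy, parent_eq_of_treeEdge h⟩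

lemma parent_of_adj {r : TreeVertex s t a b} (hr : r = .u ∨ r = .v) (x y : TreeVertex s t a b)
    (h : (treeT s t a b).Adj x y) :
    (x ≠ r ∧ x.parent = y) ∨ (y ≠ r ∧ y.parent = x) := by
  rw [treeT, SimpleGraph.fromRel_adj] at h
  rcases h.2 with h | h
  · exact parent_of_treeEdge hr h
  · exact (parent_of_treeEdge hr h).symm

lemma parent_parent_ne {r : TreeVertex s t a b} (hr : r = .u ∨ r = .v) (x y : TreeVertex s t a b)
    (hx : x ≠ r) (hy : y ≠ r) (h : x.parent = y) : y.parent ≠ x := by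
  subst h
  cases x with
  | u => rcases hr with rfl | rfl <;> simp [parent] at hx hy
  | v => rcases hr with rfl | rfl <;> simp [parent] at hx hy
  | leafU i => simp [parent]
  | leafV i => simp [parent]
  | pathA i =>
    by_cases h : (i : ℕ) = 0
    · simp [parent, h]
    · by_cases h' : (i : ℕ) - 1 = 0 <;> simp [parent, h, h', Fin.ext_iff]; omega
  | pathB i =>
    by_cases h : (i : ℕ) = 0
    · simp [parent, h]
    · by_cases h' : (i : ℕ) - 1 = 0 <;> simp [parent, h, h', Fin.ext_iff]; omega

/-- The vertices of `T(s, t; a, b)` sorted by kind. -/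
def equivSum : TreeVertex s t a b ≃ Bool ⊕ Fin s ⊕ Fin t ⊕ Fin a ⊕ Fin b where
  toFun
    | .u => .inl true
    | .v => .inl false
    | .leafU i => .inr (.inl i)
    | .leafV i => .inr (.inr (.inl i))
    | .pathA i => .inr (.inr (.inr (.inl i)))
    | .pathB i => .inr (.inr (.inr (.inr i)))
  invFun
    | .inl true => .u
    | .inl false => .v
    | .inr (.inl i) => .leafU i
    | .inr (.inr (.inl i)) => .leafV i
    | .inr (.inr (.inr (.inl i))) => .pathA i
    | .inr (.inr (.inr (.inr i))) => .pathB i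
  left_inv x := by cases x <;> rfl
  right_inv x := by rcases x with (_ | _) | _ | _ | _ | _ <;> rfl

lemma card_ne (r : TreeVertex s t a b) [Fintype {x // x ≠ r}] :
    Fintype.card {x // x ≠ r} = s + t + a + b + 1 := by
  classical
  have h : Fintype.card (TreeVertex s t a b) = s + t + a + b + 2 := by
    rw [Fintype.card_congr equivSum]
    simp
    ring
  have h' : Fintype.card {x // x ≠ r} = Fintype.card (TreeVertex s t a b) - 1 := by
    rw [Fintype.card_subtype_compl, Fintype.card_subtype_eq]
  omega

end TreeVertex

namespace Hypergraph

open EdgeFamily TreeVertex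

/-- `K` is the hypertree with `m` edges whose branching pattern is `q`. -/
structure IsPatternTree {W : Type*} (K : Hypergraph W) (k m : ℕ) {n : ℕ}
    (q : Fin n → Option (Fin n)) : Prop where
  exists_family : ∃ (κ : Type) (_ : Fintype κ) (E : κ → Finset K.vertexSet) (p : κ → Option κ),
    K.IsEdgeFamily E ∧ Fintype.card κ = m ∧ IsShape q p ∧ Nonempty (Branching k E p)

lemma isPatternTree_power {k s t a b n : ℕ} (hk : 3 ≤ k) {r : TreeVertex s t a b}
    (hr : r = .u ∨ r = .v) {q : Fin n → Option (Fin n)} (hq : IsShape q (powerPattern parent r)) :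
    (power (treeT s t a b) k).IsPatternTree k (s + t + a + b + 1) q := by
  classical
  exact ⟨_, inferInstance, powerFamily k fun x _ => adj_parent x, powerPattern parent r,
    isEdgeFamily_power hk _ (parent_parent_ne hr) (parent_of_adj hr), card_ne r, hq,
    nonempty_branching_power (by omega) _ (parent_parent_ne hr) (parent_of_adj hr)⟩

/-- `T(1, t; 2, 2)`, rooted at `v`, has three legs of length two. -/
lemma isShape_spider (t : ℕ) :
    IsShape spiderShape (powerPattern parent (TreeVertex.v : TreeVertex 1 t 2 2)) := by
  refine ⟨![⟨.u, by simp⟩, ⟨.leafU 0, by simp⟩, ⟨.pathA 0, by simp⟩, ⟨.pathA 1, by simp⟩,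
    ⟨.pathB 0, by simp⟩, ⟨.pathB 1, by simp⟩], ?_, ?_, ?_⟩
  · intro i j h
    fin_cases i <;> fin_cases j <;> simp at h ⊢
  · intro i
    fin_cases i <;> simp [spiderShape, powerPattern, parent]
  · rintro ⟨x, hx⟩ h
    cases x with
    | u => exact absurd ⟨0, rfl⟩ h
    | v => exact absurd rfl hx
    | leafU i => exact absurd ⟨1, by simp [Subsingleton.elim i 0]⟩ h
    | leafV i => simp [powerPattern, parent]
    | pathA i =>
      fin_cases i
      · exact absurd ⟨2, rfl⟩ h
      · exact absurd ⟨3, rfl⟩ h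
    | pathB i =>
      fin_cases i
      · exact absurd ⟨4, rfl⟩ h
      · exact absurd ⟨5, rfl⟩ h

/-- `T(s, 0; 2, 2)`, rooted at `u`, has two legs of length two at a neighbour of the root. -/
lemma isShape_fork (s : ℕ) :
    IsShape forkShape (powerPattern parent (TreeVertex.u : TreeVertex s 0 2 2)) := by
  refine ⟨![⟨.v, by simp⟩, ⟨.pathA 0, by simp⟩, ⟨.pathA 1, by simp⟩,
    ⟨.pathB 0, by simp⟩, ⟨.pathB 1, by simp⟩], ?_, ?_, ?_⟩
  · intro i j h
    fin_cases i <;> fin_cases j <;> simp at h ⊢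
  · intro i
    fin_cases i <;> simp [forkShape, powerPattern, parent]
  · rintro ⟨x, hx⟩ h
    cases x with
    | u => exact absurd rfl hx
    | v => exact absurd ⟨0, rfl⟩ h
    | leafU i => simp [powerPattern, parent]
    | leafV i => exact i.elim0
    | pathA i =>
      fin_cases i
      · exact absurd ⟨1, rfl⟩ h
      · exact absurd ⟨2, rfl⟩ h
    | pathB i =>
      fin_cases i
      · exact absurd ⟨3, rfl⟩ h
      · exact absurd ⟨4, rfl⟩ h

lemma isPatternTree_hypertreeOne {k m : ℕ} (hk : 3 ≤ k) (hm : 6 ≤ m) :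
    (hypertreeOne k m 4).IsPatternTree k m spiderShape := by
  have h := isPatternTree_power (k := k) hk (Or.inr rfl) (isShape_spider (m - 4 - 2))
  rwa [show 1 + (m - 4 - 2) + 2 + 2 + 1 = m by omega] at h

lemma isPatternTree_hypertreeTwo {k m : ℕ} (hk : 3 ≤ k) (hm : 5 ≤ m) :
    (hypertreeTwo k m 4).IsPatternTree k m forkShape := by
  have h := isPatternTree_power (k := k) hk (Or.inl rfl) (isShape_fork (m - 4 - 1))
  rwa [show m - 4 - 1 + 0 + 2 + 2 + 1 = m by omega] at h

/-! ### The comparison -/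

/-- If parent-child pairs in `G`, seen from a vertex of maximal weight, realise a pattern, then
moving all other edges to this vertex gives the hypertree with that pattern, and the spectral
radius grows unless `G` already is this hypertree. -/
theorem IsSupertree.alphaSpectralRadius_le_of_pattern {V W : Type*} {G : Hypergraph V}
    {K : Hypergraph W} [Finite G.vertexSet] [Fintype G.vertexSet] [Fintype G.edgeSet]
    [Finite K.vertexSet] {k m n : ℕ} [NeZero k] {α : ℝ} (hG : G.IsSupertree)
    (hk : 3 ≤ k) (hα0 : 0 ≤ α) (hα1 : α < 1)
    (hGk : G.IsUniform k) (hm : Fintype.card G.edgeSet = m) {x : G.vertexSet → ℝ}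
    (hx : IsMaximizer G.edgeFinset k α (G.alphaSpectralRadius k α) x) {z : G.vertexSet}
    (hz : ∀ v, x v ≤ x z) (R : Rooting G.edgeFinset z) {q : Fin n → Option (Fin n)}
    (hK : K.IsPatternTree k m q) {a : Fin n → G.edgeSet} (ha : Function.Injective a)
    (hchild : ∀ t s, q t = some s → R.Child (a s) (a t))
    (htop : ∀ t t' s, q t = some s → q t' = some s → R.top (a t) = R.top (a t')) :
    G.alphaSpectralRadius k α ≤ K.alphaSpectralRadius k α ∧
      (G.alphaSpectralRadius k α = K.alphaSpectralRadius k α → G.IsIsomorphic K) := by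
  classical
  have hE := G.isEdgeFamily_edgeFinset
  have hcard := hE.card_eq hGk
  have hpos := hx.pos_of_rooting hcard (by omega) hα0 hα1 hG.nonempty_rooting
  obtain ⟨E', p, hp, ⟨T⟩, hE'⟩ := R.exists_branching (by omega) hcard ha hchild htop
  obtain ⟨κ, _, EK, pK, hEK, hκ, hpK, ⟨TK⟩⟩ := hK.exists_family
  obtain ⟨φ, hφ⟩ := hp.exists_equiv hpK (hm.trans hκ.symm)
  obtain ⟨σ, hσ⟩ := T.exists_equiv TK φ hφ
  have hKk : K.IsUniform k := hEK.isUniform (TK.card_eq (by omega))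
  have := Fintype.ofFinite K.vertexSet
  have : Nonempty K.vertexSet := ⟨σ z⟩
  obtain ⟨y, hy⟩ := hEK.exists_isMaximizer hKk (by omega) hα0 hα1.le
  obtain ⟨h1, h2⟩ := hx.le_of_shift (by omega) hα0 hα1 hpos hz hE' (hy.le.of_equiv σ φ hσ)
  refine ⟨h1, fun h => ?_⟩
  rw [h2 h] at hσ
  exact hE.isIsomorphic hEK σ φ hσ

/-- A supertree that is not a caterpillar is dominated by one of the two extremal hypertrees. -/
theorem IsNonCaterpillar.alphaSpectralRadius_le {V : Type*} {G : Hypergraph V}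
    [Finite G.vertexSet] {k m : ℕ} [NeZero k] {α : ℝ} (hG : G.IsNonCaterpillar k m) (hk : 3 ≤ k)
    (hα0 : 0 ≤ α) (hα1 : α < 1) :
    (G.alphaSpectralRadius k α ≤ (hypertreeOne k m 4).alphaSpectralRadius k α ∧
      (G.alphaSpectralRadius k α = (hypertreeOne k m 4).alphaSpectralRadius k α →
        G.IsIsomorphic (hypertreeOne k m 4))) ∨
    (G.alphaSpectralRadius k α ≤ (hypertreeTwo k m 4).alphaSpectralRadius k α ∧
      (G.alphaSpectralRadius k α = (hypertreeTwo k m 4).alphaSpectralRadius k α →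
        G.IsIsomorphic (hypertreeTwo k m 4))) := by
  classical
  obtain ⟨hGk, hT, hm, hc⟩ := hG
  have hE := G.isEdgeFamily_edgeFinset
  have := Fintype.ofFinite G.vertexSet
  have : Finite G.edgeSet := Finite.of_injective _ hE.injective
  have := Fintype.ofFinite G.edgeSet
  have hm' : Fintype.card G.edgeSet = m := by
    rw [← hm, ← Nat.card_coe_set_eq, Nat.card_eq_fintype_card]
  have hbranch := hT.hasBranch_of_not_isCaterpillar hc
  have hne : Nonempty G.vertexSet := by
    rcases hbranch with ⟨v, -⟩ | ⟨-, v, -⟩ <;> exact ⟨v⟩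
  obtain ⟨x, hx⟩ := hE.exists_isMaximizer hGk (by omega) hα0 hα1.le
  obtain ⟨z, hz⟩ := Finite.exists_max x
  obtain ⟨R⟩ := hT.nonempty_rooting z
  rcases R.hasThreePairs_or_hasFork hbranch with ⟨a, ha, h1, h2, h3⟩ | ⟨a, ha, h1, h2, h3, h4, ht⟩
  · have hle : 6 ≤ m := by
      simpa [hm'] using Fintype.card_le_of_injective a ha
    refine Or.inl (hT.alphaSpectralRadius_le_of_pattern hk hα0 hα1 hGk hm' hx hz R
      (isPatternTree_hypertreeOne hk hle) ha ?_ ?_)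
    · intro t s h
      fin_cases t <;> simp [spiderShape] at h <;> subst h <;> assumption
    · intro t t' s h h'
      congr 2
      fin_cases t <;> fin_cases t' <;> simp [spiderShape] at h h' ⊢ <;> subst h <;> simp at h'
  · have hle : 5 ≤ m := by
      simpa [hm'] using Fintype.card_le_of_injective a ha
    refine Or.inr (hT.alphaSpectralRadius_le_of_pattern hk hα0 hα1 hGk hm' hx hz R
      (isPatternTree_hypertreeTwo hk hle) ha ?_ ?_)
    · intro t s h
      fin_cases t <;> simp [forkShape] at h <;> subst h <;> assumption
    · intro t t' s h h'
      fin_cases t <;> fin_cases t' <;> simp [forkShape] at h h' ⊢ <;> first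
        | exact ht
        | exact ht.symm
        | (subst h; simp at h')

end Hypergraph

theorem mainTheorem4 {V : Type*} (k : ℕ) [NeZero k] (hk : 3 ≤ k) (m : ℕ) (α : ℝ)
    (hα0 : 0 ≤ α) (hα1 : α < 1) (G : Hypergraph V) [Finite G.vertexSet]
    (hG : G.IsNonCaterpillar k m) :
    G.alphaSpectralRadius k α ≤
        max ((hypertreeOne k m 4).alphaSpectralRadius k α)
          ((hypertreeTwo k m 4).alphaSpectralRadius k α) ∧
      (G.alphaSpectralRadius k α =
          max ((hypertreeOne k m 4).alphaSpectralRadius k α)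
            ((hypertreeTwo k m 4).alphaSpectralRadius k α) ↔
        (G.IsIsomorphic (hypertreeOne k m 4) ∧
          (hypertreeTwo k m 4).alphaSpectralRadius k α ≤
            (hypertreeOne k m 4).alphaSpectralRadius k α) ∨
        (G.IsIsomorphic (hypertreeTwo k m 4) ∧
          (hypertreeOne k m 4).alphaSpectralRadius k α ≤
            (hypertreeTwo k m 4).alphaSpectralRadius k α)) := by
  have hle := hG.alphaSpectralRadius_le hk hα0 hα1
  have hne : Nonempty G.vertexSet := by
    obtain ⟨v | e⟩ := hG.2.1.1.nonempty
    · exact ⟨v⟩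
    · have : (e : Set V).ncard ≠ 0 := by rw [hG.1 e e.2]; omega
      obtain ⟨v, hv⟩ := Set.nonempty_of_ncard_ne_zero this
      exact ⟨⟨v, G.subset_vertexSet_of_mem_edgeSet e.2 hv⟩⟩
  refine ⟨?_, ?_, ?_⟩
  · rcases hle with h | h
    · exact h.1.trans (le_max_left _ _)
    · exact h.1.trans (le_max_right _ _)
  · intro heq
    rcases hle with h | h
    · have h1 := le_antisymm h.1 (heq ▸ le_max_left _ _)
      exact Or.inl ⟨h.2 h1, h1 ▸ heq ▸ le_max_right _ _⟩
    · have h1 := le_antisymm h.1 (heq ▸ le_max_right _ _)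
      exact Or.inr ⟨h.2 h1, h1 ▸ heq ▸ le_max_left _ _⟩
  · rintro (⟨hiso, h⟩ | ⟨hiso, h⟩)
    · rw [hiso.alphaSpectralRadius_eq hG.1 (by omega) hα0 hα1.le, max_eq_left h]
    · rw [hiso.alphaSpectralRadius_eq hG.1 (by omega) hα0 hα1.le, max_eq_right h]
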